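/- Chromotopologies. Let $C\subset\mathbb F_2^N$ be a doubly even linear code (every codeword has weight divisible by $4$) of dimension $k$. The chromotopology $A_{(N,k)}=[0,1]^N/C$ is the edge-coloured bipartite graph whose vertices are the cosets of $C$ in $\mathbb F_2^N$, where the edge of colour $c\in\{1,\dots,N\}$ at $v$ leads to $v+e_c$; cosets of even weight are white, those of odd weight are black. With the cyclic order (rainbow) $(1,2,\dots,N)$ of the colours it defines a closed surface $X_{(N,k)}$: a quadrilateral $2$-cell is attached to every closed path of length four whose colours alternate between $c$ and $c+1$, for $c=1,\dots,N$ (with $N+1$ read as $1$). (For $N=1$, where there are no such paths, $X_{(1,0)}$ is the sphere $B_1$ itself.) Let $B_N=\mathbb{CP}^1$ with a white vertex at $0$, a black vertex at $\infty$ and the edge of colour $c$ on the ray of argument $2\pi c/N$. The surface $X_{(N,k)}$ maps to $B_N$, white vertices to $0$, black vertices to $\infty$, edges of colour $c$ to the edge of colour $c$, and every $c/(c+1)$ face to the $c/(c+1)$ face of $B_N$, with a double point exactly over the face centres (the $N$-th roots of $-1$) when $N\ge 2$. Away from the face centres this map is a covering, whose fibre over $0$ is the set of white vertices; its monodromy group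 is the image of $\pi_1(B_N\setminus\{x^N=-1\},0)$ in the permutations of the white vertices. For $1\le c\le N$ let $\rho_c$ be the permutation of the white vertices that exchanges the two white vertices of every $c/(c+1)$ face, that is, follows colour $c$ and then colour $c+1$ (so $\rho_1=\mathrm{id}$ if $N=1$). The exterior tensor product $A=A_{(N_1,k_1)}\otimes A_{(N_2,k_2)}$ consists of one copy of $A_{(N_1,k_1)}$ for every vertex of $A_{(N_2,k_2)}$, with black and white interchanged in the copies at black vertices; corresponding vertices of the copies at $v$ and $v'$ are joined by an edge of colour $N_1+c$ when $v,v'$ are joined by colour $c$ in $A_{(N_2,k_2)}$. Its surface is denoted $X_{(N_1,k_1)}\otimes X_{(N_2,k_2)}$. Theorem. Let $N_1,N_2\ge 1$, let $A_{(N_1,k_1)},A_{(N_2,k_2)}$ be chromotopologies as above, $N=N_1+N_2$, $k=k_1+k_2$. Then $A=A_{(N_1,k_1)}\otimes A_{(N_2,k_2)}$ is isomorphic to the quotient of the $N$-cube by a $k$-dimensional doubly even code. Let $\rho_{c,1}$, $\rho_{c,2}$, $\rho_c$ be the permutations above for $A_{(N_1,k_1)}$, $A_{(N_2,k_2)}$,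 $A$. The monodromy groups of $X_{(N_1,k_1)}$ over $B_{N_1}$, of $X_{(N_2,k_2)}$ over $B_{N_2}$ and of $X_{(N_1,k_1)}\otimes X_{(N_2,k_2)}$ over $B_N$ are generated by the $\rho_{c,1}$ ($1\le c\le N_1-1$), the $\rho_{c,2}$ ($1\le c\le N_2-1$) and the $\rho_c$ ($1\le c\le N-1$), respectively. Put $m_i=2^{N_i-k_i-1}$. The white vertices of $A_{(N_i,k_i)}$ can be labelled $1,\dots,m_i$, and if $N_i\ge2$ then every $\rho_{c,i}$ is a product of disjoint $2$-cycles. For all such labellings there is a labelling of the white vertices of $A$ by $1,\dots,2^{N-k-1}$ such that, as permutations of the labels: (a) for $1\le c\le N_1-1$, $\rho_c=\rho_c^{(1)}\rho_c^{(2)}\cdots\rho_c^{(2^{N_2-k_2})}$, where $\rho_c^{(j)}$ is $\rho_{c,1}$ with $(j-1)m_1$ added to each entry of its $2$-cycles; (b) for $N_1+1\le c\le N-1$, $\rho_c=\rho_c^{(1)}\rho_c^{(2)}\cdots\rho_c^{(2^{N_1-k_1})}$, where $\rho_c^{(i)}$ is $\rho_{c-N_1,2}$ with each entry $j$ of its $2$-cycles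 replaced by $(j-1)2^{N_1-k_1}+i$; (c) if $N_1\ge 2$, then $\rho_{N_1}=\prod_{J=1}^{2^{N_2-k_2}}\rho_{N_1}^{(J)}$, where $\rho_{N_1}^{(J)}$ is obtained from any expression of $\rho_{N_1,1}$ as a product of disjoint $2$-cycles (the same expression, with the same order of the two entries of each cycle, for all $J$) by $$(i,l)\mapsto\bigl((J-1)m_1+i,\ (J-1+(-1)^{J+1})m_1+l\bigr);$$ for all $N_1\ge 1$, $\rho_{N_1}$ maps $(J-1)m_1+i$ to $(J-1+(-1)^{J+1})m_1+\rho_{N_1,1}(i)$ for $1\le J\le 2^{N_2-k_2}$, $1\le i\le m_1$; (d) $\rho_N=\rho_1\rho_2\cdots\rho_{N-1}$; if $N_2\ge 2$, then $\rho_N=\prod_{I=1}^{2^{N_1-k_1}}\rho_N^{(I)}$, where $\rho_N^{(I)}$ is obtained from any expression of $\rho_{N_2,2}$ as a product of disjoint $2$-cycles (the same expression for all $I$) by $$(j,l)\mapsto\bigl((j-1)2^{N_1-k_1}+I,\ (l-1)2^{N_1-k_1}+I\pm m_1\bigr),$$ with the sign $+$ for $I\le m_1$ and $-$ otherwise; for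 all $N_2\ge 1$, $\rho_N$ maps $(j-1)2^{N_1-k_1}+I$ to $(\rho_{N_2,2}(j)-1)2^{N_1-k_1}+I\pm m_1$ for $1\le I\le 2^{N_1-k_1}$, $1\le j\le m_2$, with the same rule for the sign. -/

import Mathlib

open Equiv

noncomputable section

/-! ## Chromotopologies -/

/-- The data of a chromotopology with colours `1, …, N`: an `N`-regular edge-coloured bipartite graph
in which all two-coloured paths of length four are closed.  The element `c : Fin N` stands for the
colour `c + 1`; `edge c v` is the other end of the edge of that colour at `v`; vertices of parity
`0` are white, those of parity `1` are black. -/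
structure Chromotopology (N : ℕ) where
  V : Type
  edge : Fin N → V → V
  parity : V → ZMod 2
  edge_edge : ∀ c v, edge c (edge c v) = v
  edge_comm : ∀ c d v, edge c (edge d v) = edge d (edge c v)
  parity_edge : ∀ c v, parity (edge c v) = parity v + 1

/-- A binary code of length `N` is doubly even if all weights are divisible by `4`. -/
def DoublyEven {N : ℕ} (C : Submodule (ZMod 2) (Fin N → ZMod 2)) : Prop :=
  ∀ x ∈ C, 4 ∣ hammingNorm x

/-- The sum of the coordinates; on `0/1`-vectors this is the weight modulo `2`. -/
def weightParity (N : ℕ) : (Fin N → ZMod 2) →ₗ[ZMod 2] ZMod 2 :=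
  ∑ i, LinearMap.proj i

theorem weightParity_eq {N : ℕ} (x : Fin N → ZMod 2) :
    weightParity N x = (hammingNorm x : ZMod 2) := by
  have h : ∀ a : ZMod 2, a = if a ≠ 0 then 1 else 0 := by decide
  simp only [weightParity, LinearMap.sum_apply, LinearMap.proj_apply, hammingNorm]
  rw [Finset.sum_congr rfl fun i _ => h (x i), Finset.sum_boole]

theorem DoublyEven.le_ker {N : ℕ} {C : Submodule (ZMod 2) (Fin N → ZMod 2)}
    (h : DoublyEven C) : C ≤ LinearMap.ker (weightParity N) := by
  intro x hx
  rw [LinearMap.mem_ker, weightParity_eq, ZMod.natCast_eq_zero_iff]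
  exact Dvd.dvd.trans (by norm_num) (h x hx)

namespace Chromotopology

/-- The quotient of the coloured `N`-cube by a doubly even code: vertices are the cosets, the edge
of colour `c` changes the `c`-th coordinate, and the even weight vectors are the white vertices. -/
def ofCode {N : ℕ} (C : Submodule (ZMod 2) (Fin N → ZMod 2)) (h : DoublyEven C) :
    Chromotopology N where
  V := (Fin N → ZMod 2) ⧸ C
  edge c v := v + C.mkQ (Pi.single c 1)
  parity := C.liftQ (weightParity N) h.le_ker
  edge_edge c v := by
    rw [add_assoc, ← map_add, ← Pi.single_add, show (1 : ZMod 2) + 1 = 0 from rfl]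
    simp
  edge_comm c d v := by abel
  parity_edge c v := by
    rw [map_add, Submodule.mkQ_apply, Submodule.liftQ_apply]
    simp [weightParity, Finset.sum_apply, Pi.single_apply]

/-- The exterior tensor product: one copy of `A₁` for every vertex of `A₂`, with black and white
interchanged in the copies at black vertices of `A₂`; corresponding vertices of different copies are
joined as in `A₂`, the colour `c` of `A₂` becoming the colour `N₁ + c`. -/
def tensor {N₁ N₂ : ℕ} (A₁ : Chromotopology N₁) (A₂ : Chromotopology N₂) :
    Chromotopology (N₁ + N₂) where
  V := A₁.V × A₂.V
  edge := Fin.addCases (fun c v => (A₁.edge c v.1, v.2)) (fun c v => (v.1, A₂.edge c v.2))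
  parity v := A₁.parity v.1 + A₂.parity v.2
  edge_edge c v := by
    refine Fin.addCases (fun c => ?_) (fun c => ?_) c <;> simp [edge_edge]
  edge_comm c d v := by
    refine Fin.addCases (fun c => ?_) (fun c => ?_) c <;>
      refine Fin.addCases (fun d => ?_) (fun d => ?_) d <;> simp
    · exact A₁.edge_comm c d v.1
    · exact A₂.edge_comm c d v.2
  parity_edge c v := by
    refine Fin.addCases (fun c => ?_) (fun c => ?_) c <;> simp [parity_edge] <;> ring

/-- Isomorphism of chromotopologies. -/
structure Iso {N : ℕ} (A B : Chromotopology N) where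
  toEquiv : A.V ≃ B.V
  map_edge : ∀ c v, toEquiv (A.edge c v) = B.edge c (toEquiv v)
  map_parity : ∀ v, B.parity (toEquiv v) = A.parity v

variable {N : ℕ} (A : Chromotopology N)

/-- The white vertices. -/
def White : Type := {v : A.V // A.parity v = 0}

/-- The permutation `ρ_c` of the white vertices which, for every two-coloured face of colours
`c/(c+1)` (read cyclically in the rainbow `(1, 2, …, N)`), exchanges the two white vertices of the
face: follow the edge of colour `c`, then that of the next colour. -/
def rho (c : Fin N) : Perm A.White where
  toFun w := ⟨A.edge (finRotate N c) (A.edge c w.1), by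
    rw [A.parity_edge, A.parity_edge, w.2]; rfl⟩
  invFun w := ⟨A.edge c (A.edge (finRotate N c) w.1), by
    rw [A.parity_edge, A.parity_edge, w.2]; rfl⟩
  left_inv w := Subtype.ext (by simp only [A.edge_edge])
  right_inv w := Subtype.ext (by simp only [A.edge_edge])

/-! ## The surface over `B_N`

`B_N` is the Riemann sphere with a white vertex at `0`, a black vertex at `∞` and the edge of colour
`c` on the ray of argument `2πc/N`; the centres of its faces are the `N`-th roots of `-1`.

Cutting every quadrilateral two-coloured face of the surface of `A` from its centre to the midpoints
of its four sides gives four corners, and the `N` corners at a vertex form a closed disc around it.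
So the surface is obtained by gluing one disc for every vertex: a copy of `{|z| ≤ 1}` for a white
vertex and a copy of `{|z| ≥ 1} ∪ {∞}` for a black one, where the discs of the two ends of an edge of
colour `c` are glued along the arc of the unit circle centred at the midpoint of the edge of
colour `c` of `B_N`, between the centres of the two adjacent faces. The projection to `B_N` is `z`. -/

/-- The disc in `B_N` around its white vertex (`q = 0`) or its black vertex. -/
def disc (q : ZMod 2) : Set (OnePoint ℂ) :=
  if q = 0 then {z | ∃ x : ℂ, z = x ∧ ‖x‖ ≤ 1}
  else {z | z = OnePoint.infty ∨ ∃ x : ℂ, z = x ∧ 1 ≤ ‖x‖}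

/-- The arc of the unit circle around the midpoint of the edge of colour `c + 1` of `B_N`. -/
def arc (N : ℕ) (c : Fin N) : Set (OnePoint ℂ) :=
  {z | ∃ θ : ℝ, |θ - 2 * Real.pi * ((c : ℕ) + 1) / N| ≤ Real.pi / N ∧
    z = (Complex.exp (θ * Complex.I) : ℂ)}

/-- The centres of the faces of `B_N`. -/
def centres (N : ℕ) : Set (OnePoint ℂ) := {z | ∃ x : ℂ, z = x ∧ x ^ N = -1}

/-- The disjoint union of the discs of all vertices. -/
abbrev Discs : Type := Σ v : A.V, disc (A.parity v)

/-- The gluing of the discs at the two ends of an edge. -/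
def Glue (p q : A.Discs) : Prop :=
  ∃ c : Fin N, q.1 = A.edge c p.1 ∧ (q.2 : OnePoint ℂ) = p.2 ∧ (p.2 : OnePoint ℂ) ∈ arc N c

/-- The surface of `A` for the rainbow `(1, 2, …, N)`, with the quotient topology. -/
abbrev Surface : Type := Quot A.Glue

/-- The projection of the surface to `B_N`, unramified away from the centres of the faces. -/
def toSphere : A.Surface → OnePoint ℂ :=
  Quot.lift (fun p => (p.2 : OnePoint ℂ)) (by rintro p q ⟨c, -, h, -⟩; exact h.symm)

/-- The part of the projection over the complement of the centres of the faces. -/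
def proj : A.toSphere ⁻¹' (centres N)ᶜ → ((centres N)ᶜ : Set (OnePoint ℂ)) :=
  (centres N)ᶜ.restrictPreimage A.toSphere

theorem zero_mem_compl_centres (N : ℕ) : ((0 : ℂ) : OnePoint ℂ) ∈ (centres N)ᶜ := by
  rintro ⟨x, hx, h⟩
  rw [OnePoint.coe_eq_coe] at hx
  subst hx
  rcases Nat.eq_zero_or_pos N with rfl | hN
  · norm_num at h
  · rw [zero_pow hN.ne'] at h
    norm_num at h

/-- The white vertex of `B_N`, used as base point. -/
def base (N : ℕ) : ((centres N)ᶜ : Set (OnePoint ℂ)) :=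
  ⟨((0 : ℂ) : OnePoint ℂ), zero_mem_compl_centres N⟩

/-- A white vertex as a point of the surface: the centre of its disc. -/
def point (w : A.White) : A.Surface :=
  Quot.mk _ ⟨w.1, ((0 : ℂ) : OnePoint ℂ), by simp [disc, w.2]⟩

/-- The set `S` of permutations of the white vertices generates the monodromy group of the surface
over `B_N`: away from the centres of the faces the projection is a covering map, its fibre over the
white vertex of `B_N` consists of the white vertices, and the image of the fundamental group in the
permutations of this fibre is the group generated by `S`. -/
def MonodromyGeneratedBy (S : Set (Perm A.White)) : Prop :=
  ∃ (cov : IsCoveringMap A.proj) (e : A.White ≃ (A.proj ⁻¹' {base N} : Set _)),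
    (∀ w, ((e w).1 : A.Surface) = A.point w) ∧
    (cov.monodromyPerm (base N)).range =
      (Subgroup.closure S).map (e.permCongrHom : Perm A.White →* Perm _)

/-! ## Labelled permutations -/

/-- A labelling of the white vertices by `1, …, m`. -/
abbrev Labeling (m : ℕ) : Type := A.White ≃ {i : ℕ // i ∈ Finset.Icc 1 m}

variable {A} in
/-- `ρ_c` as a permutation of the labels (all integers that are not labels are fixed). -/
def labeledRho {m : ℕ} (l : A.Labeling m) (c : Fin N) : Perm ℕ :=
  (A.rho c).extendDomain l

end Chromotopology

/-- `L` writes `σ` as a product of disjoint `2`-cycles. -/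
structure IsTwoCycleDecomposition (σ : Perm ℕ) (L : List (ℕ × ℕ)) : Prop where
  nodup : (L.flatMap fun p => [p.1, p.2]).Nodup
  prod_eq : σ = (L.map fun p => swap p.1 p.2).prod

/-- The product of the cycles `(f i, g l)` over the cycles `(i, l)` in the list `L`. -/
def relabel (L : List (ℕ × ℕ)) (f g : ℕ → ℕ) : Perm ℕ :=
  (L.map fun p => swap (f p.1) (g p.2)).prod

/-- The product `s 1 * s 2 * ⋯ * s n`. -/
def orderedProd (n : ℕ) (s : ℕ → Perm ℕ) : Perm ℕ :=
  ((List.range' 1 n).map s).prod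

/-- `J + (-1) ^ (J + 1)`: the partner of `J` in the pairing `1 ↔ 2`, `3 ↔ 4`, … . -/
def partner (J : ℕ) : ℕ := if Odd J then J + 1 else J - 1

end

noncomputable section

/-! ### Discs, arcs and face centres in the sphere -/

namespace Chromotopology

/-! Covering. Over the complement of all arcs but the one of colour `c + 1` (`arcNhd`), only that
colour is glued. There the surface is a disjoint union of sheets, one for each white vertex
(`sheetEquiv`). These open sets cover everything except the face centres.

Monodromy. No presentation of the fundamental group is needed. Edges of different colours commute,
so the `rho c` commute with each other and extend to self-maps `faceMap` of the surface over the
sphere; monodromy commutes with such maps (`IsCoveringMap.monodromy_map_comm`). Since the graph is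
connected, the `rho c` without the last colour generate a transitive group (`Connected.transitive`),
and a permutation commuting with a transitive group is determined by one value
(`Perm.eq_of_apply_eq_of_commute`). Hence every loop acts as the group element that agrees with it
at one white vertex. Conversely, a path in the surface from `w` to `rho c w` projects to a loop that
acts as `rho c`.

Tensor product. Its code is the kernel of `tensorMap`, the direct sum of the two codes, and weights
add. A white vertex `(v₁, v₂)` has components of equal parity `b`. Let `i`, `j` be the labels of the
white ends of the first-colour edges at `v₁`, `v₂`; the label of the pair is `(2(j - 1) + b)m₁ + i`.
In blocks of length `m₁`, flipping `b` exchanges partner blocks; in blocks of length `2m₁`, it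
shifts the position by `±m₁`. Two consecutive colours of one factor change only `i` or only `j`, by
the `rho` of that factor. The two mixed pairs flip `b` and combine the last colour of one factor
with the first colour of the other. The first colour does not change the white end taken along it,
and the last colour changes it by a full `rho`, because the first colour is its cyclic successor.
Finally `eq_orderedProd_relabel` turns these formulas into products of cycles; it applies because
the `rho` of a factor with at least two colours has no fixed point (`rho_ofCode_ne`). -/

theorem disc_zero : disc 0 = {z : OnePoint ℂ | ∃ x : ℂ, z = x ∧ ‖x‖ ≤ 1} := if_pos rfl

theorem disc_one : disc 1 = {z : OnePoint ℂ | z = OnePoint.infty ∨ ∃ x : ℂ, z = x ∧ 1 ≤ ‖x‖} :=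
  if_neg (by decide)

theorem disc_zero_union_disc_one : disc 0 ∪ disc 1 = Set.univ := by
  rw [disc_zero, disc_one, Set.eq_univ_iff_forall]
  intro z
  induction z using OnePoint.rec with
  | infty => exact Or.inr (Or.inl rfl)
  | coe x =>
    rcases le_total ‖x‖ 1 with h | h
    · exact Or.inl ⟨x, rfl, h⟩
    · exact Or.inr (Or.inr ⟨x, rfl, h⟩)

theorem isClosed_disc_zero : IsClosed (disc 0) := by
  have : disc 0 = ((↑) : ℂ → OnePoint ℂ) '' Metric.closedBall 0 1 := by
    rw [disc_zero]
    ext z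
    simp [eq_comm, and_comm]
  rw [this]
  exact ((isCompact_closedBall 0 1).image OnePoint.continuous_coe).isClosed

theorem isClosed_disc_one : IsClosed (disc 1) := by
  have : disc 1 = (((↑) : ℂ → OnePoint ℂ) '' Metric.ball 0 1)ᶜ := by
    rw [disc_one]
    ext z
    induction z using OnePoint.rec with
    | infty => simp
    | coe x => simp
  rw [this]
  exact (OnePoint.isOpenEmbedding_coe.isOpenMap _ Metric.isOpen_ball).isClosed_compl

theorem arc_subset_disc (N : ℕ) (c : Fin N) (q : ZMod 2) : arc N c ⊆ disc q := by
  rintro z ⟨θ, -, rfl⟩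
  have h : ‖Complex.exp (θ * Complex.I)‖ = 1 := Complex.norm_exp_ofReal_mul_I θ
  fin_cases q
  · exact disc_zero ▸ ⟨_, rfl, h.le⟩
  · exact disc_one ▸ Or.inr ⟨_, rfl, h.ge⟩

theorem isClosed_arc (N : ℕ) (c : Fin N) : IsClosed (arc N c) := by
  have : arc N c = (fun θ : ℝ => ((Complex.exp (θ * Complex.I) : ℂ) : OnePoint ℂ)) ''
      Metric.closedBall (2 * Real.pi * ((c : ℕ) + 1) / N) (Real.pi / N) := by
    ext z
    simp only [arc, Set.mem_ofPred_eq, Set.mem_image, Metric.mem_closedBall, Real.dist_eq]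
    exact exists_congr fun θ => and_congr_right fun _ => eq_comm
  rw [this]
  refine ((isCompact_closedBall _ _).image ?_).isClosed
  exact OnePoint.continuous_coe.comp (by fun_prop)

theorem exists_mem_arc {N : ℕ} (hN : 0 < N) {z : OnePoint ℂ} (h₀ : z ∈ disc 0) (h₁ : z ∈ disc 1) :
    ∃ c, z ∈ arc N c := by
  rw [disc_zero] at h₀
  rw [disc_one] at h₁
  obtain ⟨x, rfl, hx⟩ := h₀
  obtain h | ⟨y, hy, hy'⟩ := h₁
  · simp at h
  rw [OnePoint.coe_eq_coe] at hy
  subst hy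
  have hx1 : ‖x‖ = 1 := le_antisymm hx hy'
  have hexp : Complex.exp (Complex.arg x * Complex.I) = x := by
    have := Complex.norm_mul_exp_arg_mul_I x
    rwa [hx1, Complex.ofReal_one, one_mul] at this
  have hN' : (0 : ℝ) < N := by exact_mod_cast hN
  have hZ : (0 : ℤ) < N := by exact_mod_cast hN
  have hπ := Real.pi_pos
  -- The nearest edge ray is the `r`-th multiple of `2π/N`. Its colour is congruent to `r` modulo
  -- `N`, so its index is `(r - 1) % N`, and the quotient `(r - 1) / N` counts the full turns to
  -- subtract from the argument.
  set r : ℤ := round (Complex.arg x * N / (2 * Real.pi))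
  have hr := abs_sub_round (Complex.arg x * N / (2 * Real.pi))
  change |_ - (r : ℝ)| ≤ _ at hr
  have hlt := Int.emod_lt_of_pos (r - 1) hZ
  have hnn := Int.emod_nonneg (r - 1) hZ.ne'
  have hdiv := Int.emod_add_mul_ediv (r - 1) N
  refine ⟨⟨((r - 1) % N).toNat, by omega⟩, Complex.arg x - (((r - 1) / N : ℤ) : ℝ) * (2 * Real.pi),
    ?_, ?_⟩
  · have hc : (((((r - 1) % N).toNat : ℕ) : ℝ)) + 1 = r - N * (((r - 1) / N : ℤ) : ℝ) := by
      have h1 : ((((r - 1) % N).toNat : ℕ) : ℤ) = r - 1 - N * ((r - 1) / N) := by omega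
      have h2 : (((((r - 1) % N).toNat : ℕ) : ℤ) : ℝ) = r - 1 - N * (((r - 1) / N : ℤ) : ℝ) := by
        rw [h1]; push_cast; ring
      rw [Int.cast_natCast] at h2
      rw [h2]; ring
    simp only [hc]
    have : Complex.arg x - (((r - 1) / N : ℤ) : ℝ) * (2 * Real.pi) -
        2 * Real.pi * (r - N * (((r - 1) / N : ℤ) : ℝ)) / N =
        (2 * Real.pi / N) * (Complex.arg x * N / (2 * Real.pi) - r) := by
      field_simp
      ring
    rw [this, abs_mul, abs_of_pos (by positivity)]
    calc _ ≤ 2 * Real.pi / N * (1 / 2) := by gcongr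
      _ = _ := by ring
  · rw [OnePoint.coe_eq_coe]
    conv_lhs => rw [← hexp]
    rw [Complex.exp_eq_exp_iff_exists_int]
    refine ⟨(r - 1) / N, ?_⟩
    push_cast
    ring

/-- Each arc reaches half a step to either side of its edge ray, so different arcs can share only
endpoints, which lie halfway between neighbouring rays. -/
theorem mem_centres_of_mem_arc {N : ℕ} {c d : Fin N} (hcd : c ≠ d) {z : OnePoint ℂ}
    (hc : z ∈ arc N c) (hd : z ∈ arc N d) : z ∈ centres N := by
  obtain ⟨θ, hθ, rfl⟩ := hc
  obtain ⟨θ', hθ', h⟩ := hd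
  rw [OnePoint.coe_eq_coe, Complex.exp_eq_exp_iff_exists_int] at h
  obtain ⟨n, hn⟩ := h
  have hN : 0 < N := c.pos
  have hN' : (0 : ℝ) < N := by exact_mod_cast hN
  have hπ := Real.pi_pos
  have hn' : θ = θ' + n * (2 * Real.pi) := by
    have := congrArg Complex.im hn
    simpa using this
  have scale (t : ℝ) (a : ℕ) (ht : |t - 2 * Real.pi * (a + 1) / N| ≤ Real.pi / N) :
      |t * N - 2 * Real.pi * (a + 1)| ≤ Real.pi := by
    have : t * N - 2 * Real.pi * (a + 1) = (t - 2 * Real.pi * (a + 1) / N) * N := by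
      field_simp
    rw [this, abs_mul, abs_of_pos hN']
    calc _ ≤ Real.pi / N * N := by gcongr
      _ = _ := by field_simp
  have h1 := abs_le.1 (scale _ _ hθ)
  have h2 := abs_le.1 (scale _ _ hθ')
  -- The signed number of steps between the two rays, full turns taken into account. The arc bounds
  -- force `|m| ≤ 1`, distinct colours exclude `0`, and `m = ±1` makes both bounds equalities.
  obtain ⟨m, hm⟩ : ∃ m : ℤ, m = (c : ℤ) - d - n * N := ⟨_, rfl⟩
  have hmR : (m : ℝ) = (c : ℕ) - (d : ℕ) - n * N := by rw [hm]; push_cast; ring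
  have key : θ * N - 2 * Real.pi * ((c : ℕ) + 1) =
      θ' * N - 2 * Real.pi * ((d : ℕ) + 1) - 2 * Real.pi * m := by
    rw [hmR, hn']; ring
  have hm1 : m ≤ 1 := by
    by_contra! hcon
    have : (2 : ℝ) ≤ m := by exact_mod_cast hcon
    nlinarith
  have hm2 : -1 ≤ m := by
    by_contra! hcon
    have : (m : ℝ) ≤ -2 := by exact_mod_cast (by omega : m ≤ -2)
    nlinarith
  have hm0 : m ≠ 0 := by
    rintro rfl
    have h3 := c.2
    have h4 := d.2
    have hne : (c : ℕ) ≠ d := fun h => hcd (Fin.ext h)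
    rcases lt_trichotomy n 0 with h | h | h
    · nlinarith
    · subst h; omega
    · nlinarith
  refine ⟨_, rfl, ?_⟩
  rw [← Complex.exp_nat_mul]
  have goal (s : ℤ) (hs : θ * N = 2 * Real.pi * s + Real.pi) :
      Complex.exp (N * (θ * Complex.I)) = -1 := by
    have : (N : ℂ) * (θ * Complex.I) = s * (2 * Real.pi * Complex.I) + Real.pi * Complex.I := by
      have : ((θ * N : ℝ) : ℂ) = ((2 * Real.pi * s + Real.pi : ℝ) : ℂ) := by rw [hs]
      push_cast at this
      linear_combination Complex.I * this
    rw [this, Complex.exp_add, Complex.exp_int_mul_two_pi_mul_I, Complex.exp_pi_mul_I, one_mul]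
  obtain rfl | rfl : m = 1 ∨ m = -1 := by omega
  · refine goal (c : ℕ) ?_
    push_cast at key ⊢
    linarith
  · refine goal ((c : ℕ) + 1) ?_
    push_cast at key ⊢
    linarith

/-- The complement of all arcs but the one of colour `c + 1`. -/
def arcNhd (N : ℕ) (c : Fin N) : Set (OnePoint ℂ) := (⋃ d ∈ {d | d ≠ c}, arc N d)ᶜ

theorem mem_arcNhd {N : ℕ} {c : Fin N} {z : OnePoint ℂ} :
    z ∈ arcNhd N c ↔ ∀ d, z ∈ arc N d → d = c := by
  simp only [arcNhd, Set.mem_compl_iff, Set.mem_iUnion, Set.mem_ofPred_eq, not_exists]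
  exact forall_congr' fun d => ⟨fun h hz => by_contra fun hd => h hd hz, fun h hd hz => hd (h hz)⟩

theorem isOpen_arcNhd (N : ℕ) (c : Fin N) : IsOpen (arcNhd N c) :=
  (Set.Finite.isClosed_biUnion (Set.toFinite _) fun d _ => isClosed_arc N d).isOpen_compl

/-- A point that is not a centre lies on at most one arc. If it lies on none, any colour serves. -/
theorem exists_mem_arcNhd {N : ℕ} (hN : 0 < N) {z : OnePoint ℂ} (hz : z ∉ centres N) :
    ∃ c, z ∈ arcNhd N c := by
  by_cases h : ∃ c, z ∈ arc N c
  · obtain ⟨c, hc⟩ := h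
    exact ⟨c, mem_arcNhd.2 fun d hd => by_contra fun hne => hz (mem_centres_of_mem_arc hne hd hc)⟩
  · exact ⟨⟨0, hN⟩, mem_arcNhd.2 fun d hd => (h ⟨d, hd⟩).elim⟩

theorem mem_arc_of_mem_arcNhd {N : ℕ} {c : Fin N} {z : OnePoint ℂ} (hz : z ∈ arcNhd N c)
    (h₀ : z ∈ disc 0) (h₁ : z ∈ disc 1) : z ∈ arc N c := by
  obtain ⟨d, hd⟩ := exists_mem_arc c.pos h₀ h₁
  exact mem_arcNhd.1 hz d hd ▸ hd

/-! ### Sheets of the surface and the covering property -/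

variable {N : ℕ} (A : Chromotopology N)

theorem parity_edge_eq_one {c : Fin N} {v : A.V} (h : A.parity v = 0) :
    A.parity (A.edge c v) = 1 := by rw [A.parity_edge, h, zero_add]

theorem parity_edge_eq_zero {c : Fin N} {v : A.V} (h : A.parity v ≠ 0) :
    A.parity (A.edge c v) = 0 := by
  have : ∀ a : ZMod 2, a ≠ 0 → a + 1 = 0 := by decide
  rw [A.parity_edge, this _ h]

/-- A vertex of parity `0` as a white vertex. -/
def white (v : A.V) (h : A.parity v = 0) : A.White := ⟨v, h⟩

theorem white_val (w : A.White) : A.white w.1 w.2 = w := rfl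

/-- The white end of the edge of colour `c + 1` at `v`. -/
def whiteEnd (c : Fin N) (v : A.V) : A.White :=
  if h : A.parity v = 0 then A.white v h else A.white (A.edge c v) (A.parity_edge_eq_zero h)

theorem whiteEnd_of_white (c : Fin N) {v : A.V} (h : A.parity v = 0) :
    A.whiteEnd c v = A.white v h := dif_pos h

theorem whiteEnd_of_black (c : Fin N) {v : A.V} (h : A.parity v ≠ 0) :
    A.whiteEnd c v = A.white (A.edge c v) (A.parity_edge_eq_zero h) := dif_neg h

/-- This invariance lets the white end descend to the glued surface as the label of a sheet. -/
theorem whiteEnd_edge (c : Fin N) (v : A.V) : A.whiteEnd c (A.edge c v) = A.whiteEnd c v := by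
  by_cases h : A.parity v = 0
  · rw [A.whiteEnd_of_white c h, A.whiteEnd_of_black c (by rw [A.parity_edge_eq_one h]; decide)]
    exact Subtype.ext (A.edge_edge c v)
  · rw [A.whiteEnd_of_black c h, A.whiteEnd_of_white c (A.parity_edge_eq_zero h)]

theorem continuous_toSphere : Continuous A.toSphere :=
  continuous_quot_lift _ (continuous_sigma fun _ => continuous_subtype_val)

theorem discs_ext {p q : A.Discs} (h₁ : p.1 = q.1) (h₂ : (p.2 : OnePoint ℂ) = q.2) : p = q := by
  obtain ⟨v, z, hz⟩ := p
  obtain ⟨w, y, hy⟩ := q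
  obtain rfl : v = w := h₁
  obtain rfl : z = y := h₂
  rfl

theorem mem_disc_one_of_notMem {z : OnePoint ℂ} (h : z ∉ disc 0) : z ∈ disc 1 :=
  ((disc_zero_union_disc_one ▸ Set.mem_univ z : z ∈ disc 0 ∪ disc 1)).resolve_left h

theorem disc_parity_of_black {v : A.V} (h : A.parity v ≠ 0) : disc (A.parity v) = disc 1 := by
  have : ∀ a : ZMod 2, a ≠ 0 → a = 1 := by decide
  rw [this _ h]

theorem mem_disc_parity (w : A.White) {z : OnePoint ℂ} (h : z ∈ disc 0) :
    z ∈ disc (A.parity w.1) := by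
  rw [w.2]
  exact h

theorem mem_disc_parity_edge (c : Fin N) (w : A.White) {z : OnePoint ℂ} (h : z ∈ disc 1) :
    z ∈ disc (A.parity (A.edge c w.1)) := by
  rw [A.parity_edge_eq_one w.2]
  exact h

open Classical in
/-- The lift of a point of `B_N` to the surface, in the discs around the white vertex `w` and the
black vertex at the other end of the edge of colour `c + 1`. -/
def sheet (c : Fin N) (w : A.White) (z : OnePoint ℂ) : A.Surface :=
  if h : z ∈ disc 0 then Quot.mk _ ⟨w.1, z, A.mem_disc_parity w h⟩
  else Quot.mk _ ⟨A.edge c w.1, z, A.mem_disc_parity_edge c w (mem_disc_one_of_notMem h)⟩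

theorem sheet_of_mem (c : Fin N) (w : A.White) {z : OnePoint ℂ} (h : z ∈ disc 0) :
    A.sheet c w z = Quot.mk _ ⟨w.1, z, A.mem_disc_parity w h⟩ := dif_pos h

theorem sheet_of_notMem (c : Fin N) (w : A.White) {z : OnePoint ℂ} (h : z ∉ disc 0) :
    A.sheet c w z =
      Quot.mk _ ⟨A.edge c w.1, z, A.mem_disc_parity_edge c w (mem_disc_one_of_notMem h)⟩ :=
  dif_neg h

theorem toSphere_sheet (c : Fin N) (w : A.White) (z : OnePoint ℂ) :
    A.toSphere (A.sheet c w z) = z := by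
  by_cases h : z ∈ disc 0
  · rw [A.sheet_of_mem c w h]; rfl
  · rw [A.sheet_of_notMem c w h]; rfl

/-- The only case that needs gluing is a point of a black disc on the unit circle: over `arcNhd N c`
it lies on the arc of `c`, so it is identified with a point of the white disc in the same sheet. -/
theorem mk_eq_sheet {c : Fin N} (p : A.Discs) (hp : (p.2 : OnePoint ℂ) ∈ arcNhd N c) :
    (Quot.mk _ p : A.Surface) = A.sheet c (A.whiteEnd c p.1) p.2 := by
  by_cases hv : A.parity p.1 = 0
  · have hz : (p.2 : OnePoint ℂ) ∈ disc 0 := hv ▸ p.2.2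
    rw [A.whiteEnd_of_white c hv, A.sheet_of_mem c _ hz]
    rfl
  · have hz : (p.2 : OnePoint ℂ) ∈ disc 1 := A.disc_parity_of_black hv ▸ p.2.2
    rw [A.whiteEnd_of_black c hv]
    by_cases h₀ : (p.2 : OnePoint ℂ) ∈ disc 0
    · rw [A.sheet_of_mem c _ h₀]
      exact Quot.sound ⟨c, rfl, rfl, mem_arc_of_mem_arcNhd hp h₀ hz⟩
    · rw [A.sheet_of_notMem c _ h₀]
      exact congrArg _ (A.discs_ext (A.edge_edge c p.1).symm rfl)

theorem sheet_surjective {c : Fin N} (x : A.Surface) (hx : A.toSphere x ∈ arcNhd N c) :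
    ∃ w, A.sheet c w (A.toSphere x) = x := by
  obtain ⟨p, rfl⟩ := Quot.exists_rep x
  exact ⟨_, (A.mk_eq_sheet p hx).symm⟩

open Classical in
/-- The white vertex in the sheet of a point over `arcNhd N c`. -/
def sheetLabel (c : Fin N) : A.Surface → Option A.White :=
  Quot.lift (fun p => if (p.2 : OnePoint ℂ) ∈ arcNhd N c then some (A.whiteEnd c p.1) else none) <| by
    -- Inside `arcNhd N c` the gluing colour must be `c`, which preserves the white end; outside,
    -- both labels are `none`.
    rintro p q ⟨d, h₁, h₂, h₃⟩
    simp only [h₂]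
    split_ifs with h
    · obtain rfl := mem_arcNhd.1 h d h₃
      rw [h₁, whiteEnd_edge]
    · rfl

theorem sheetLabel_mk {c : Fin N} (p : A.Discs) (h : (p.2 : OnePoint ℂ) ∈ arcNhd N c) :
    A.sheetLabel c (Quot.mk _ p) = some (A.whiteEnd c p.1) := if_pos h

theorem sheetLabel_sheet {c : Fin N} (w : A.White) {z : OnePoint ℂ} (hz : z ∈ arcNhd N c) :
    A.sheetLabel c (A.sheet c w z) = some w := by
  by_cases h : z ∈ disc 0
  · rw [A.sheet_of_mem c w h, A.sheetLabel_mk _ hz, A.whiteEnd_of_white c w.2]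
    rfl
  · rw [A.sheet_of_notMem c w h, A.sheetLabel_mk _ hz, A.whiteEnd_edge, A.whiteEnd_of_white c w.2]
    rfl

theorem continuous_mk_disc (v : A.V) :
    Continuous fun z : disc (A.parity v) => (Quot.mk _ ⟨v, z⟩ : A.Surface) :=
  continuous_quot_mk.comp continuous_sigmaMk

/-- Pasting over the two closed discs. `sheet` uses the white disc on the unit circle, but by
`mk_eq_sheet` it agrees there with the inclusion of the black disc. -/
theorem continuousOn_sheet (c : Fin N) (w : A.White) :
    ContinuousOn (A.sheet c w) (arcNhd N c) := by
  have h₀ : ContinuousOn (A.sheet c w) (arcNhd N c ∩ disc 0) := by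
    rw [continuousOn_iff_continuous_domRestrict]
    refine ((A.continuous_mk_disc w.1).comp (g := fun z => Quot.mk _ ⟨w.1, z⟩)
      (f := fun z : ↥(arcNhd N c ∩ disc 0) => ⟨z.1, A.mem_disc_parity w z.2.2⟩) (by fun_prop)).congr fun z => ?_
    exact (A.sheet_of_mem c w z.2.2).symm
  have h₁ : ContinuousOn (A.sheet c w) (arcNhd N c ∩ disc 1) := by
    rw [continuousOn_iff_continuous_domRestrict]
    refine ((A.continuous_mk_disc (A.edge c w.1)).comp (g := fun z => Quot.mk _ ⟨A.edge c w.1, z⟩)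
      (f := fun z : ↥(arcNhd N c ∩ disc 1) => ⟨z.1, A.mem_disc_parity_edge c w z.2.2⟩)
      (by fun_prop)).congr fun z => ?_
    simp only [Function.comp]
    rw [A.mk_eq_sheet (c := c) _ z.2.1, A.whiteEnd_edge, A.whiteEnd_of_white c w.2]
    rfl
  have hU : arcNhd N c = (arcNhd N c ∩ disc 0) ∪ (arcNhd N c ∩ disc 1) := by
    rw [← Set.inter_union_distrib_left, disc_zero_union_disc_one, Set.inter_univ]
  intro z hz
  -- At a point outside the closed set `D`, continuity within `D` is vacuous.
  have key (D : Set (OnePoint ℂ)) (hD : IsClosed D) (h : ContinuousOn (A.sheet c w) (arcNhd N c ∩ D)) :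
      ContinuousWithinAt (A.sheet c w) (arcNhd N c ∩ D) z := by
    by_cases hzD : z ∈ D
    · exact h z ⟨hz, hzD⟩
    · refine continuousWithinAt_of_notMem_closure fun hcl => hzD ?_
      exact hD.closure_subset_iff.2 Set.inter_subset_right hcl
  rw [hU]
  exact (key _ isClosed_disc_zero h₀).union (key _ isClosed_disc_one h₁)

instance : TopologicalSpace A.White := ⊥

instance : DiscreteTopology A.White := ⟨rfl⟩

/-- The part of the surface over `arcNhd N c` is a disjoint union of copies of `arcNhd N c`. -/
def sheetEquiv (c : Fin N) : arcNhd N c × A.White ≃ A.toSphere ⁻¹' arcNhd N c :=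
  Equiv.ofBijective
    (fun p => ⟨A.sheet c p.2 p.1, by
      rw [Set.mem_preimage, A.toSphere_sheet]; exact p.1.2⟩) <| by
    constructor
    · rintro ⟨z, w⟩ ⟨z', w'⟩ h
      have h' : A.sheet c w z = A.sheet c w' z' := congrArg Subtype.val h
      have hz : (z : OnePoint ℂ) = z' := by
        rw [← A.toSphere_sheet c w z, h', A.toSphere_sheet]
      have hw : some w = some w' := by
        rw [← A.sheetLabel_sheet w z.2, h', A.sheetLabel_sheet w' z'.2]
      exact Prod.ext (Subtype.ext hz) (Option.some.inj hw)
    · rintro ⟨x, hx⟩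
      obtain ⟨w, hw⟩ := A.sheet_surjective x hx
      exact ⟨(⟨_, hx⟩, w), Subtype.ext hw⟩

theorem continuous_sheetEquiv (c : Fin N) : Continuous (A.sheetEquiv c) := by
  refine continuous_prod_of_discrete_right.2 fun w => Continuous.subtype_mk ?_ _
  exact continuousOn_iff_continuous_domRestrict.1 (A.continuousOn_sheet c w)

/-- Over `arcNhd N c` the label depends only on the vertex, so the preimage in each disc is either
all of the part over `arcNhd N c` or empty. -/
theorem isOpen_sheetLabel (c : Fin N) (w : A.White) : IsOpen {x | A.sheetLabel c x = some w} := by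
  rw [← isQuotientMap_quot_mk.isOpen_preimage, isOpen_sigma_iff]
  intro v
  by_cases hv : A.whiteEnd c v = w
  · convert (isOpen_arcNhd N c).preimage (continuous_subtype_val (p := (· ∈ disc (A.parity v))))
      using 1
    ext z
    simp only [Set.mem_preimage, Set.mem_ofPred_eq]
    refine ⟨fun h => ?_, fun h => by rw [A.sheetLabel_mk _ h, hv]⟩
    by_contra hz
    have : A.sheetLabel c (Quot.mk _ ⟨v, z⟩) = none := if_neg hz
    simp [this] at h
  · convert isOpen_empty
    refine Set.eq_empty_of_forall_notMem fun z (hz : A.sheetLabel c (Quot.mk _ ⟨v, z⟩) = some w) => ?_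
    by_cases h : (z : OnePoint ℂ) ∈ arcNhd N c
    · rw [A.sheetLabel_mk _ h] at hz
      exact hv (Option.some.inj hz)
    · have : A.sheetLabel c (Quot.mk _ ⟨v, z⟩) = none := if_neg h
      simp [this] at hz

theorem sheetLabel_sheetEquiv (c : Fin N) (p : arcNhd N c × A.White) :
    A.sheetLabel c (A.sheetEquiv c p) = some p.2 := A.sheetLabel_sheet p.2 p.1.2

theorem toSphere_sheetEquiv (c : Fin N) (p : arcNhd N c × A.White) :
    A.toSphere (A.sheetEquiv c p) = p.1 := A.toSphere_sheet c p.2 p.1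

theorem continuous_sheetEquiv_symm (c : Fin N) : Continuous (A.sheetEquiv c).symm := by
  refine Continuous.prodMk (f := fun x => ((A.sheetEquiv c).symm x).1)
    (g := fun x => ((A.sheetEquiv c).symm x).2) ?_ ?_
  · refine continuous_induced_rng.2 ((A.continuous_toSphere.comp continuous_subtype_val).congr ?_)
    intro x
    obtain ⟨p, rfl⟩ := (A.sheetEquiv c).surjective x
    simp [toSphere_sheetEquiv]
  · rw [continuous_discrete_rng]
    intro w
    convert (A.isOpen_sheetLabel c w).preimage
      (continuous_subtype_val (p := (· ∈ A.toSphere ⁻¹' arcNhd N c))) using 1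
    ext x
    obtain ⟨p, rfl⟩ := (A.sheetEquiv c).surjective x
    simp only [Set.mem_preimage, Equiv.symm_apply_apply, Set.mem_singleton_iff, Set.mem_ofPred_eq]
    rw [A.sheetLabel_sheetEquiv, Option.some_inj]

theorem isCoveringMap_proj (hN : 0 < N) : IsCoveringMap A.proj := by
  refine IsCoveringMapOn.isCoveringMap_restrictPreimage _ fun z hz => ?_
  obtain ⟨c, hc⟩ := exists_mem_arcNhd hN hz
  refine IsEvenlyCovered.to_isEvenlyCovered_preimage (I := A.White)
    ⟨inferInstance, arcNhd N c, hc, isOpen_arcNhd N c,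
      (isOpen_arcNhd N c).preimage A.continuous_toSphere,
      ⟨(A.sheetEquiv c).symm, A.continuous_sheetEquiv_symm c, A.continuous_sheetEquiv c⟩, fun x => ?_⟩
  obtain ⟨p, rfl⟩ := (A.sheetEquiv c).surjective x
  change (((A.sheetEquiv c).symm (A.sheetEquiv c p)).1 : OnePoint ℂ) = _
  rw [Equiv.symm_apply_apply, A.toSphere_sheetEquiv]

end Chromotopology

/-! ### Monodromy and permutations commuting with a transitive group -/

/-- Monodromy commutes with continuous maps over the base. -/
theorem IsCoveringMap.monodromy_map_comm {E X : Type*} [TopologicalSpace E] [TopologicalSpace X]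
    {p : E → X} (cov : IsCoveringMap p) (g : C(E, E)) (hg : ∀ e, p (g e) = p e) {x y : X}
    (γ : Path.Homotopic.Quotient x y) (e : p ⁻¹' {x}) :
    ((cov.monodromy γ ⟨g e, (hg e).trans e.2⟩ : p ⁻¹' {y}) : E) = g (cov.monodromy γ e) := by
  obtain ⟨γ⟩ := γ
  have h₀ : γ 0 = p e := γ.source.trans e.2.symm
  -- Uniqueness of lifts: the image under `g` of the lift from `e` is the lift from `g e`.
  have : g.comp (cov.liftPath γ e h₀) = cov.liftPath γ (g e) (h₀.trans (hg e).symm) := by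
    rw [cov.eq_liftPath_iff']
    refine ⟨?_, congrArg g (cov.liftPath_zero _ _ _)⟩
    rw [← cov.liftPath_lifts γ e h₀]
    funext t
    exact hg _
  exact (DFunLike.congr_fun this 1).symm

namespace Equiv.Perm

/-- Permutations which commute with a transitive group are determined by one value. -/
theorem eq_of_apply_eq_of_commute {α : Type*} {G : Subgroup (Perm α)}
    (htrans : ∀ a b, ∃ g ∈ G, g a = b) {σ τ : Perm α} (hσ : ∀ g ∈ G, Commute σ g)
    (hτ : ∀ g ∈ G, Commute τ g) {a : α} (h : σ a = τ a) : σ = τ := by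
  ext b
  obtain ⟨g, hg, rfl⟩ := htrans a b
  rw [← mul_apply, (hσ g hg).eq, mul_apply, h, ← mul_apply, ← (hτ g hg).eq, mul_apply]

end Equiv.Perm

/-! ### Comparison of the monodromy group with the face permutations -/

namespace Chromotopology

variable {N : ℕ} (A : Chromotopology N)

theorem commute_rho (c d : Fin N) : Commute (A.rho c) (A.rho d) := by
  refine Equiv.ext fun w => Subtype.ext ?_
  change A.edge _ (A.edge _ (A.edge _ (A.edge _ w.1))) = A.edge _ (A.edge _ (A.edge _ (A.edge _ w.1)))
  rw [A.edge_comm c, A.edge_comm (finRotate N c), A.edge_comm c d, A.edge_comm _ d]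

theorem zero_mem_arcNhd (c : Fin N) : ((0 : ℂ) : OnePoint ℂ) ∈ arcNhd N c := by
  rw [mem_arcNhd]
  rintro d ⟨θ, -, h⟩
  rw [OnePoint.coe_eq_coe] at h
  exact (Complex.exp_ne_zero _ h.symm).elim

theorem zero_mem_disc_zero : ((0 : ℂ) : OnePoint ℂ) ∈ disc 0 := disc_zero ▸ ⟨0, rfl, by simp⟩

theorem point_eq_sheet (c : Fin N) (w : A.White) : A.point w = A.sheet c w ((0 : ℂ) : OnePoint ℂ) :=
  (A.sheet_of_mem c w zero_mem_disc_zero).symm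

theorem point_mem (w : A.White) : A.point w ∈ A.toSphere ⁻¹' (centres N)ᶜ :=
  zero_mem_compl_centres N

/-- The fibre over the white vertex of `B_N` consists of the white vertices. -/
def fiberEquiv (hN : 0 < N) : A.White ≃ (A.proj ⁻¹' {base N} : Set _) :=
  Equiv.ofBijective (fun w => ⟨⟨A.point w, A.point_mem w⟩, rfl⟩) <| by
    constructor
    · intro w w' h
      have h' : A.point w = A.point w' := congrArg (fun x => (x.1 : A.Surface)) h
      rw [A.point_eq_sheet ⟨0, hN⟩, A.point_eq_sheet ⟨0, hN⟩] at h'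
      have := congrArg (A.sheetLabel ⟨0, hN⟩) h'
      rw [sheetLabel_sheet _ _ (zero_mem_arcNhd _), sheetLabel_sheet _ _ (zero_mem_arcNhd _)] at this
      exact Option.some.inj this
    · rintro ⟨⟨x, hx⟩, h⟩
      have hx0 : A.toSphere x = ((0 : ℂ) : OnePoint ℂ) := congrArg Subtype.val h
      obtain ⟨w, hw⟩ := A.sheet_surjective (c := ⟨0, hN⟩) x (hx0 ▸ zero_mem_arcNhd _)
      rw [hx0, ← A.point_eq_sheet] at hw
      exact ⟨w, Subtype.ext (Subtype.ext hw)⟩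

/-- The self-map of the discs induced by a self-map of the vertices. -/
def discsMap (f : A.V → A.V) (hp : ∀ v, A.parity (f v) = A.parity v) (p : A.Discs) : A.Discs :=
  ⟨f p.1, p.2, (hp p.1).symm ▸ p.2.2⟩

theorem continuous_discsMap (f : A.V → A.V) (hp : ∀ v, A.parity (f v) = A.parity v) :
    Continuous (A.discsMap f hp) := by
  refine continuous_sigma fun v => ?_
  exact (continuous_sigmaMk (σ := fun v : A.V => disc (A.parity v))).comp
    (f := fun z : disc (A.parity v) => (⟨z, (hp v).symm ▸ z.2⟩ : disc (A.parity (f v))))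
    (continuous_subtype_val.subtype_mk _)

/-- Following the edges of the colours `c + 1` and `d + 1`, as a self-map of the surface. -/
def faceMap (c d : Fin N) : A.Surface → A.Surface :=
  Quot.map (A.discsMap (fun v => A.edge d (A.edge c v)) fun v => by
    rw [A.parity_edge, A.parity_edge, add_assoc]; exact add_zero _) <| by
    rintro p q ⟨i, h₁, h₂, h₃⟩
    refine ⟨i, ?_, h₂, h₃⟩
    change A.edge d (A.edge c q.1) = A.edge i (A.edge d (A.edge c p.1))
    rw [h₁, A.edge_comm c i, A.edge_comm d i]

theorem continuous_faceMap (c d : Fin N) : Continuous (A.faceMap c d) :=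
  continuous_quot_map _ (A.continuous_discsMap _ _)

theorem toSphere_faceMap (c d : Fin N) (x : A.Surface) :
    A.toSphere (A.faceMap c d x) = A.toSphere x := by
  obtain ⟨p, rfl⟩ := Quot.exists_rep x
  rfl

theorem faceMap_mem (c d : Fin N) {x : A.Surface} (hx : x ∈ A.toSphere ⁻¹' (centres N)ᶜ) :
    A.faceMap c d x ∈ A.toSphere ⁻¹' (centres N)ᶜ := by
  rwa [Set.mem_preimage, A.toSphere_faceMap]

/-- `faceMap` over the complement of the centres of the faces. -/
def faceMapRestrict (c d : Fin N) :
    C(A.toSphere ⁻¹' (centres N)ᶜ, A.toSphere ⁻¹' (centres N)ᶜ) where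
  toFun x := ⟨A.faceMap c d x, A.faceMap_mem c d x.2⟩
  continuous_toFun := ((A.continuous_faceMap c d).comp continuous_subtype_val).subtype_mk _

theorem proj_faceMapRestrict (c d : Fin N) (x) : A.proj (A.faceMapRestrict c d x) = A.proj x :=
  Subtype.ext (A.toSphere_faceMap c d x)

/-- The monodromy of a loop as a permutation of the white vertices. -/
def whiteMonodromy (hN : 0 < N) : FundamentalGroup _ (base N) →* Perm A.White :=
  ((A.fiberEquiv hN).symm.permCongrHom : Perm _ →* Perm A.White).comp
    ((A.isCoveringMap_proj hN).monodromyPerm (base N))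

theorem fiberEquiv_whiteMonodromy (hN : 0 < N) (γ : FundamentalGroup _ (base N)) (w : A.White) :
    A.fiberEquiv hN (A.whiteMonodromy hN γ w) =
      (A.isCoveringMap_proj hN).monodromy γ (A.fiberEquiv hN w) :=
  (A.fiberEquiv hN).apply_symm_apply _

/-- On the fibre over the base point, `rho c` is the restriction of a self-map of the surface over
the sphere. -/
theorem commute_whiteMonodromy_rho (hN : 0 < N) (γ : FundamentalGroup _ (base N)) (c : Fin N) :
    Commute (A.whiteMonodromy hN γ) (A.rho c) := by
  have key (w : A.White) : ((A.fiberEquiv hN (A.rho c w)).1) =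
      A.faceMapRestrict c (finRotate N c) (A.fiberEquiv hN w) := rfl
  refine Equiv.ext fun w => (A.fiberEquiv hN).injective (Subtype.ext ?_)
  change (A.fiberEquiv hN (A.whiteMonodromy hN γ (A.rho c w))).1 =
    (A.fiberEquiv hN (A.rho c (A.whiteMonodromy hN γ w))).1
  rw [key, A.fiberEquiv_whiteMonodromy, A.fiberEquiv_whiteMonodromy]
  exact (A.isCoveringMap_proj hN).monodromy_map_comm (A.faceMapRestrict c (finRotate N c))
    (A.proj_faceMapRestrict c _) γ (A.fiberEquiv hN w)

theorem joinedIn_disc (v : A.V) {f : unitInterval → ℂ} (hf : Continuous f)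
    (hd : ∀ t, (f t : OnePoint ℂ) ∈ disc (A.parity v)) (hc : ∀ t, f t ^ N ≠ -1) :
    JoinedIn (A.toSphere ⁻¹' (centres N)ᶜ) (Quot.mk _ ⟨v, f 0, hd 0⟩) (Quot.mk _ ⟨v, f 1, hd 1⟩) := by
  refine ⟨⟨⟨fun t => Quot.mk _ ⟨v, f t, hd t⟩, ?_⟩, rfl, rfl⟩, ?_⟩
  · exact (A.continuous_mk_disc v).comp ((OnePoint.continuous_coe.comp hf).subtype_mk _)
  · rintro t ⟨x, hx, h⟩
    obtain rfl : f t = x := OnePoint.coe_eq_coe.1 hx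
    exact hc t h

/-- The argument of the edge of colour `c + 1` of `B_N`. -/
def edgeArg (c : Fin N) : ℝ := 2 * Real.pi * ((c : ℕ) + 1) / N

theorem midpoint_mem_arc (c : Fin N) :
    ((Complex.exp (edgeArg c * Complex.I) : ℂ) : OnePoint ℂ) ∈ arc N c := by
  refine ⟨edgeArg c, ?_, rfl⟩
  rw [edgeArg, sub_self, abs_zero]
  positivity

theorem midpoint_pow (c : Fin N) : Complex.exp (edgeArg c * Complex.I) ^ N = 1 := by
  rw [← Complex.exp_nat_mul, Complex.exp_eq_one_iff]
  refine ⟨(c : ℕ) + 1, ?_⟩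
  have : (N : ℂ) ≠ 0 := by exact_mod_cast c.pos.ne'
  simp only [edgeArg]
  push_cast
  field_simp

theorem pow_ne_neg_one_of_norm_ne_one (hN : 0 < N) {x : ℂ} (h : ‖x‖ ≠ 1) : x ^ N ≠ -1 := by
  intro hx
  have := congrArg norm hx
  rw [norm_pow, norm_neg, norm_one] at this
  exact h ((pow_eq_one_iff_of_nonneg (norm_nonneg x) hN.ne').1 this)

/-- The midpoint of the edge of colour `c + 1` in the disc of a vertex. -/
def midpoint (c : Fin N) (v : A.V) : A.Surface :=
  Quot.mk _ ⟨v, _, arc_subset_disc N c _ (midpoint_mem_arc c)⟩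

theorem midpoint_edge (c : Fin N) (v : A.V) : A.midpoint c (A.edge c v) = A.midpoint c v :=
  (Quot.sound ⟨c, rfl, rfl, midpoint_mem_arc c⟩).symm

theorem joinedIn_point_midpoint (c : Fin N) (w : A.White) :
    JoinedIn (A.toSphere ⁻¹' (centres N)ᶜ) (A.point w) (A.midpoint c w.1) := by
  have hn (t : unitInterval) : ‖(t : ℂ) * Complex.exp (edgeArg c * Complex.I)‖ = t := by
    rw [norm_mul, Complex.norm_exp_ofReal_mul_I, mul_one, Complex.norm_real,
      Real.norm_of_nonneg t.2.1]
  convert A.joinedIn_disc w.1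
    (f := fun t : unitInterval => (t : ℂ) * Complex.exp (edgeArg c * Complex.I))
    (by fun_prop) (fun t => ?_) (fun t => ?_)
  · exact congrArg (Quot.mk _) (A.discs_ext rfl (by simp))
  · exact congrArg (Quot.mk _) (A.discs_ext rfl (by simp))
  · exact A.mem_disc_parity w (disc_zero ▸ ⟨_, rfl, (hn t).trans_le t.2.2⟩)
  · by_cases h : (t : ℝ) = 1
    · rw [h, Complex.ofReal_one, one_mul, midpoint_pow]
      norm_num
    · exact pow_ne_neg_one_of_norm_ne_one c.pos ((hn t).trans_ne h)

theorem joinedIn_midpoint_midpoint (c d : Fin N) {v : A.V} (hv : A.parity v = 1) :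
    JoinedIn (A.toSphere ⁻¹' (centres N)ᶜ) (A.midpoint c v) (A.midpoint d v) := by
  -- The factor `1 + t(1 - t)` pushes the path off the unit circle, and so away from the face
  -- centres, for `0 < t < 1`. At the ends it passes through edge midpoints, whose `N`-th power is
  -- `1`.
  have hn (t : unitInterval) : ‖((1 + t * (1 - t) : ℝ) : ℂ) *
      Complex.exp (((1 - t) * edgeArg c + t * edgeArg d : ℝ) * Complex.I)‖ = 1 + t * (1 - t) := by
    have := t.2.1
    have := sub_nonneg.2 t.2.2
    rw [norm_mul, Complex.norm_exp_ofReal_mul_I, mul_one, Complex.norm_real,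
      Real.norm_of_nonneg (by positivity)]
  convert A.joinedIn_disc v
    (f := fun t : unitInterval => ((1 + t * (1 - t) : ℝ) : ℂ) *
      Complex.exp (((1 - t) * edgeArg c + t * edgeArg d : ℝ) * Complex.I))
    (by fun_prop) (fun t => ?_) (fun t => ?_)
  · exact congrArg (Quot.mk _) (A.discs_ext rfl (by simp))
  · exact congrArg (Quot.mk _) (A.discs_ext rfl (by simp))
  · rw [hv, disc_one]
    refine Or.inr ⟨_, rfl, ?_⟩
    rw [hn t]
    nlinarith [t.2.1, t.2.2]
  · by_cases h0 : (t : ℝ) = 0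
    · simp only [h0]
      simp [midpoint_pow]
      norm_num
    by_cases h1 : (t : ℝ) = 1
    · simp only [h1]
      simp [midpoint_pow]
      norm_num
    refine pow_ne_neg_one_of_norm_ne_one c.pos ?_
    rw [hn t]
    have := mul_ne_zero h0 (sub_ne_zero.2 (Ne.symm h1))
    intro h
    apply this
    linarith

/-- The path runs out along the edge of colour `c + 1`, through the black disc to the midpoint of
the next colour, and back along that edge. -/
theorem joinedIn_point_rho (c : Fin N) (w : A.White) :
    JoinedIn (A.toSphere ⁻¹' (centres N)ᶜ) (A.point w) (A.point (A.rho c w)) := by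
  refine (A.joinedIn_point_midpoint c w).trans ?_
  refine JoinedIn.trans ?_ (A.joinedIn_point_midpoint (finRotate N c) (A.rho c w)).symm
  change JoinedIn _ _ (A.midpoint (finRotate N c) (A.edge (finRotate N c) (A.edge c w.1)))
  rw [midpoint_edge, ← A.midpoint_edge c w.1]
  exact A.joinedIn_midpoint_midpoint _ _ (A.parity_edge_eq_one w.2)

/-- The path just found has both ends over the base point, so its projection is a loop of which it
is itself a lift. Agreement at a single `w` is enough, by rigidity. -/
theorem exists_whiteMonodromy_apply (hN : 0 < N) (c : Fin N) (w : A.White) :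
    ∃ γ, A.whiteMonodromy hN γ w = A.rho c w := by
  have h := joinedIn_iff_joined (A.point_mem w) (A.point_mem (A.rho c w)) |>.1
    (A.joinedIn_point_rho c w)
  let Γ : Path.Homotopic.Quotient (A.fiberEquiv hN w).1 (A.fiberEquiv hN (A.rho c w)).1 :=
    Path.Homotopic.Quotient.mk h.some
  have cov := A.isCoveringMap_proj hN
  refine ⟨(Γ.map ⟨A.proj, cov.continuous⟩).cast (A.fiberEquiv hN w).2.symm
    (A.fiberEquiv hN (A.rho c w)).2.symm, (A.fiberEquiv hN).injective ?_⟩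
  rw [A.fiberEquiv_whiteMonodromy]
  exact cov.monodromy_eq_of_map_eq Γ ((Path.Homotopic.Quotient.cast_cast _ _ _ _ _).trans
    (Path.Homotopic.Quotient.cast_rfl_rfl _)).symm

/-- If the permutations of the white vertices by `rho c`, for all colours but the last one,
generate a transitive group, then they generate the monodromy group. -/
theorem monodromyGeneratedBy_rho (hN : 0 < N) {S : Set (Perm A.White)}
    (hS : ∀ σ, σ ∈ S → ∃ c, σ = A.rho c)
    (htrans : ∀ w w', ∃ g ∈ Subgroup.closure S, g w = w') : A.MonodromyGeneratedBy S := by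
  refine ⟨A.isCoveringMap_proj hN, A.fiberEquiv hN, fun w => rfl, ?_⟩
  have hcomm (σ : Perm A.White) (hσ : ∀ c, Commute σ (A.rho c)) :
      ∀ g ∈ Subgroup.closure S, Commute σ g := by
    intro g hg
    induction hg using Subgroup.closure_induction with
    | mem x hx =>
      obtain ⟨c, rfl⟩ := hS x hx
      exact hσ c
    | one => exact Commute.one_right σ
    | mul x y _ _ hx hy => exact hx.mul_right hy
    | inv x _ hx => exact hx.inv_right
  have hG : ∀ g ∈ Subgroup.closure S, ∀ c, Commute g (A.rho c) := fun g hg c =>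
    (hcomm _ (fun d => A.commute_rho c d) g hg).symm
  have hrange : (A.whiteMonodromy hN).range = Subgroup.closure S := by
    apply le_antisymm
    · rintro _ ⟨γ, rfl⟩
      rcases isEmpty_or_nonempty A.White with h | ⟨⟨w⟩⟩
      · rw [Subsingleton.elim (A.whiteMonodromy hN γ) 1]
        exact one_mem _
      · obtain ⟨g, hg, h⟩ := htrans w (A.whiteMonodromy hN γ w)
        rw [← Perm.eq_of_apply_eq_of_commute htrans (hcomm g (hG g hg))
          (hcomm _ (A.commute_whiteMonodromy_rho hN γ)) h]
        exact hg
    · rw [Subgroup.closure_le]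
      intro σ hσ
      obtain ⟨c, rfl⟩ := hS σ hσ
      rcases isEmpty_or_nonempty A.White with h | ⟨⟨w⟩⟩
      · rw [Subsingleton.elim (A.rho c) 1]
        exact one_mem _
      · obtain ⟨γ, h⟩ := A.exists_whiteMonodromy_apply hN c w
        exact ⟨γ, Perm.eq_of_apply_eq_of_commute htrans
          (hcomm _ (A.commute_whiteMonodromy_rho hN γ)) (hcomm _ (A.commute_rho c)) h⟩
  -- `whiteMonodromy` was transported to the white vertices by `fiberEquiv`; conjugating back
  -- cancels this.
  rw [← hrange, whiteMonodromy, MonoidHom.range_comp, Subgroup.map_map]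
  convert (Subgroup.map_id _).symm
  ext σ x
  simp

end Chromotopology

/-! ### Telescoping products, connectedness and counting -/

theorem finRotate_of_succ_lt {N : ℕ} {c : Fin N} (h : (c : ℕ) + 1 < N) :
    finRotate N c = ⟨c + 1, h⟩ := by
  obtain _ | n := N
  · exact c.elim0
  · exact finRotate_of_lt (by omega)

theorem finRotate_of_succ_eq {N : ℕ} (hN : 0 < N) {c : Fin N} (h : (c : ℕ) + 1 = N) :
    finRotate N c = ⟨0, hN⟩ := by
  obtain _ | n := N
  · exact c.elim0
  · obtain rfl : c = Fin.last n := Fin.ext (by simpa using h)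
    exact finRotate_last

theorem finRotate_ne_self {N : ℕ} (hN : 2 ≤ N) (c : Fin N) : finRotate N c ≠ c := by
  intro h
  by_cases hc : (c : ℕ) + 1 < N
  · rw [finRotate_of_succ_lt hc] at h
    have := congrArg Fin.val h
    simp at this
  · have hc' : (c : ℕ) + 1 = N := by omega
    rw [finRotate_of_succ_eq c.pos hc'] at h
    have := congrArg Fin.val h
    simp only at this
    omega

/-- A unit vector has odd weight, so the code is a proper subspace. -/
theorem DoublyEven.finrank_lt {N : ℕ} (hN : 0 < N) {C : Submodule (ZMod 2) (Fin N → ZMod 2)}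
    (h : DoublyEven C) : Module.finrank (ZMod 2) C < N := by
  refine (Submodule.finrank_lt fun htop => ?_).trans_eq (Module.finrank_fin_fun (ZMod 2))
  have hmem : (Pi.single ⟨0, hN⟩ 1 : Fin N → ZMod 2) ∈ C := htop ▸ Submodule.mem_top
  have := h.le_ker hmem
  simp [weightParity, Finset.sum_apply, Pi.single_apply] at this

namespace Chromotopology

variable {N : ℕ} (A : Chromotopology N)

/-- Following the edges of the colours `c + 1` and `d + 1`, as a permutation of the white
vertices. -/
def face (c d : Fin N) : Perm A.White where
  toFun w := A.white (A.edge d (A.edge c w.1)) (by rw [A.parity_edge, A.parity_edge, w.2]; rfl)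
  invFun w := A.white (A.edge c (A.edge d w.1)) (by rw [A.parity_edge, A.parity_edge, w.2]; rfl)
  left_inv w := Subtype.ext (by simp only [white, A.edge_edge])
  right_inv w := Subtype.ext (by simp only [white, A.edge_edge])

theorem rho_eq_face (c : Fin N) : A.rho c = A.face c (finRotate N c) := rfl

theorem rho_val (c : Fin N) (w : A.White) :
    (A.rho c w).1 = A.edge (finRotate N c) (A.edge c w.1) := rfl

theorem face_comm (c d : Fin N) : A.face c d = A.face d c :=
  Equiv.ext fun _ => Subtype.ext (A.edge_comm _ _ _)

theorem face_self (c : Fin N) : A.face c c = 1 :=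
  Equiv.ext fun _ => Subtype.ext (A.edge_edge _ _)

theorem face_mul_face (b c d : Fin N) : A.face b c * A.face c d = A.face b d := by
  rw [A.face_comm b c, A.face_comm c d, A.face_comm b d]
  refine Equiv.ext fun w => Subtype.ext ?_
  change A.edge b (A.edge c (A.edge c (A.edge d w.1))) = A.edge b (A.edge d w.1)
  rw [A.edge_edge]

/-- The product telescopes: adjacent factors share a colour, which cancels by `face_mul_face`. -/
theorem prod_rho_castLE {n : ℕ} (h : n < N) :
    ((List.finRange n).map fun c => A.rho (Fin.castLE h.le c)).prod =
      A.face ⟨0, n.zero_le.trans_lt h⟩ ⟨n, h⟩ := by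
  induction n with
  | zero => exact (A.face_self _).symm
  | succ n ih =>
    rw [List.finRange_succ_last, List.map_append, List.prod_append, List.map_map]
    have := ih (n.lt_succ_self.trans h)
    simp only [List.map_singleton, List.prod_singleton]
    rw [rho_eq_face, finRotate_of_succ_lt (by simpa using h)]
    exact (congrArg (· * _) this).trans (A.face_mul_face _ _ _)

/-- The last face joins the last colour to the first. Since edges commute, this is the face from the
first colour to the last, i.e. the full telescoping product. -/
theorem rho_last_eq_prod {c : Fin N} (hc : (c : ℕ) + 1 = N) :
    A.rho c = ((List.finRange N).dropLast.map A.rho).prod := by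
  rw [rho_eq_face, finRotate_of_succ_eq c.pos hc, face_comm]
  obtain _ | n := N
  · exact c.elim0
  · rw [List.finRange_succ_last, List.dropLast_concat, List.map_map]
    obtain rfl : c = ⟨n, n.lt_succ_self⟩ := Fin.ext (by simpa using hc)
    exact (A.prod_rho_castLE n.lt_succ_self).symm

theorem face_zero_mem_closure (hN : 0 < N) (c : Fin N) :
    A.face ⟨0, hN⟩ c ∈ Subgroup.closure {σ | ∃ c : Fin N, (c : ℕ) + 1 < N ∧ σ = A.rho c} := by
  obtain ⟨n, hn⟩ := c
  rw [← A.prod_rho_castLE hn]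
  refine Subgroup.list_prod_mem _ fun σ hσ => Subgroup.subset_closure ?_
  obtain ⟨c, -, rfl⟩ := List.mem_map.1 hσ
  exact ⟨_, (Nat.succ_le_of_lt c.2).trans_lt hn, rfl⟩

/-- Any two vertices are joined by a path. -/
def Connected : Prop := ∀ v v', Relation.ReflTransGen (fun a b => ∃ c, b = A.edge c a) v v'

variable {A}

/-- Along a path in the graph, take at each vertex the white end of its first-colour edge. A step of
colour `c` moves this white end by the face of the first colour and `c`, which lies in the group by
telescoping. -/
theorem Connected.transitive (hN : 0 < N) (hA : A.Connected) (w w' : A.White) :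
    ∃ g ∈ Subgroup.closure {σ | ∃ c : Fin N, (c : ℕ) + 1 < N ∧ σ = A.rho c}, g w = w' := by
  have key : ∀ v, Relation.ReflTransGen (fun a b => ∃ c, b = A.edge c a) w.1 v →
      ∃ g ∈ Subgroup.closure {σ | ∃ c : Fin N, (c : ℕ) + 1 < N ∧ σ = A.rho c},
        g w = A.whiteEnd ⟨0, hN⟩ v := by
    intro v hv
    induction hv with
    | refl => exact ⟨1, one_mem _, (A.whiteEnd_of_white _ w.2).symm⟩
    | @tail v u _ hu ih =>
      obtain ⟨c, rfl⟩ := hu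
      obtain ⟨g, hg, h⟩ := ih
      refine ⟨A.face ⟨0, hN⟩ c * g, mul_mem (A.face_zero_mem_closure hN c) hg, ?_⟩
      rw [Perm.mul_apply, h]
      by_cases hv : A.parity v = 0
      · rw [A.whiteEnd_of_white _ hv, A.whiteEnd_of_black _ (by
          rw [A.parity_edge_eq_one hv]; exact one_ne_zero)]
        exact Subtype.ext (A.edge_comm _ _ _)
      · rw [A.whiteEnd_of_black _ hv, A.whiteEnd_of_white _ (A.parity_edge_eq_zero hv)]
        exact Subtype.ext (congrArg (A.edge c) (A.edge_edge _ _))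
  obtain ⟨g, hg, h⟩ := key w'.1 (hA _ _)
  exact ⟨g, hg, h.trans (A.whiteEnd_of_white _ w'.2)⟩

theorem Connected.monodromyGeneratedBy (hN : 0 < N) (hA : A.Connected) :
    A.MonodromyGeneratedBy {σ | ∃ c : Fin N, (c : ℕ) + 1 < N ∧ σ = A.rho c} :=
  A.monodromyGeneratedBy_rho hN (fun _ ⟨c, _, h⟩ => ⟨c, h⟩) (hA.transitive hN)

theorem connected_ofCode (C : Submodule (ZMod 2) (Fin N → ZMod 2)) (h : DoublyEven C) :
    (ofCode C h).Connected := by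
  have key (x : Fin N → ZMod 2) (v : (Fin N → ZMod 2) ⧸ C) :
      Relation.ReflTransGen (fun a b => ∃ c, b = a + C.mkQ (Pi.single c 1)) v (v + C.mkQ x) := by
    induction x using Pi.single_induction generalizing v with
    | zero => rw [map_zero, add_zero]
    | add x y hx hy =>
      rw [map_add, ← add_assoc]
      exact (hx v).trans (hy _)
    | single i a =>
      have : a = 0 ∨ a = 1 := by revert a; decide
      rcases this with rfl | rfl
      · rw [Pi.single_zero, map_zero, add_zero]
      · exact Relation.ReflTransGen.single ⟨i, rfl⟩
  intro (v : (Fin N → ZMod 2) ⧸ C) (v' : (Fin N → ZMod 2) ⧸ C)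
  obtain ⟨x, hx⟩ := C.mkQ_surjective (v' - v)
  have := key x v
  rw [hx, add_sub_cancel] at this
  exact this

theorem tensor_edge_castAdd {N₁ N₂ : ℕ} (A₁ : Chromotopology N₁) (A₂ : Chromotopology N₂)
    (c : Fin N₁) (v : A₁.V × A₂.V) :
    (A₁.tensor A₂).edge (Fin.castAdd N₂ c) v = (A₁.edge c v.1, v.2) := by
  simp [tensor]

theorem tensor_edge_natAdd {N₁ N₂ : ℕ} (A₁ : Chromotopology N₁) (A₂ : Chromotopology N₂)
    (c : Fin N₂) (v : A₁.V × A₂.V) :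
    (A₁.tensor A₂).edge (Fin.natAdd N₁ c) v = (v.1, A₂.edge c v.2) := by
  simp [tensor]

theorem Connected.tensor {N₁ N₂ : ℕ} {A₁ : Chromotopology N₁} {A₂ : Chromotopology N₂}
    (h₁ : A₁.Connected) (h₂ : A₂.Connected) : (A₁.tensor A₂).Connected := by
  rintro ⟨v₁, v₂⟩ ⟨u₁, u₂⟩
  refine Relation.ReflTransGen.trans (b := ((u₁, v₂) : A₁.V × A₂.V)) ?_ ?_
  · refine (h₁ v₁ u₁).lift (fun v => ((v, v₂) : A₁.V × A₂.V)) ?_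
    rintro a _ ⟨c, rfl⟩
    exact ⟨Fin.castAdd N₂ c, (tensor_edge_castAdd A₁ A₂ c (a, v₂)).symm⟩
  · refine (h₂ v₂ u₂).lift (fun v => ((u₁, v) : A₁.V × A₂.V)) ?_
    rintro a _ ⟨c, rfl⟩
    exact ⟨Fin.natAdd N₁ c, (tensor_edge_natAdd A₁ A₂ c (u₁, a)).symm⟩

variable (A)

/-- A vertex is determined by its parity and the white end of the edge of a given colour. -/
def whiteEndEquiv (c : Fin N) : A.V ≃ A.White × ZMod 2 where
  toFun v := (A.whiteEnd c v, A.parity v)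
  invFun p := if p.2 = 0 then p.1.1 else A.edge c p.1.1
  left_inv v := by
    by_cases h : A.parity v = 0
    · simp only [A.whiteEnd_of_white c h, if_pos h]; rfl
    · simp only [A.whiteEnd_of_black c h, if_neg h]
      exact A.edge_edge c v
  right_inv := by
    rintro ⟨w, b⟩
    by_cases h : b = 0
    · simp only [if_pos h]
      rw [A.whiteEnd_of_white c w.2, w.2, h, white_val]
    · have : ∀ b : ZMod 2, b ≠ 0 → b = 1 := by decide
      simp only [if_neg h]
      rw [A.whiteEnd_edge, A.whiteEnd_of_white c w.2, A.parity_edge, w.2, this b h, white_val, zero_add]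

theorem card_white_ofCode (hN : 0 < N) {C : Submodule (ZMod 2) (Fin N → ZMod 2)}
    (h : DoublyEven C) :
    Nat.card (ofCode C h).White = 2 ^ (N - Module.finrank (ZMod 2) C - 1) := by
  have hV : Nat.card (ofCode C h).V = 2 ^ (N - Module.finrank (ZMod 2) C) := by
    have h1 := Module.natCard_eq_pow_finrank (K := ZMod 2) (V := (Fin N → ZMod 2) ⧸ C)
    rw [Submodule.finrank_quotient, Module.finrank_fin_fun, Nat.card_zmod] at h1
    exact h1
  have hlt := h.finrank_lt hN
  rw [Nat.card_congr ((ofCode C h).whiteEndEquiv ⟨0, hN⟩), Nat.card_prod, Nat.card_zmod] at hV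
  obtain ⟨n, hn⟩ : ∃ n, N - Module.finrank (ZMod 2) C = n + 1 := ⟨_, (Nat.succ_pred (by omega)).symm⟩
  rw [hn, pow_succ] at hV
  rw [hn, Nat.add_sub_cancel]
  omega

theorem rho_rho (c : Fin N) (w : A.White) : A.rho c (A.rho c w) = w := by
  refine Subtype.ext ?_
  rw [rho_val, rho_val, A.edge_comm c (finRotate N c), A.edge_edge, A.edge_edge]

/-- A fixed vertex would put a sum of two distinct unit vectors, of weight `2`, into the code. -/
theorem rho_ofCode_ne (hN : 2 ≤ N) {C : Submodule (ZMod 2) (Fin N → ZMod 2)} (h : DoublyEven C)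
    (c : Fin N) (w : (ofCode C h).White) : (ofCode C h).rho c w ≠ w := by
  intro hw
  let x : (Fin N → ZMod 2) ⧸ C := w.1
  have h1 : x + C.mkQ (Pi.single c 1) +
      C.mkQ (Pi.single (finRotate N c) 1) = x := congrArg Subtype.val hw
  rw [add_assoc, add_eq_left, ← map_add, Submodule.mkQ_apply, Submodule.Quotient.mk_eq_zero] at h1
  have hne := finRotate_ne_self hN c
  generalize finRotate N c = d at h1 hne
  have h2 := h _ h1
  have h3 : hammingNorm (Pi.single c 1 + Pi.single d 1 : Fin N → ZMod 2) = 2 := by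
    refine (congrArg Finset.card ?_).trans (Finset.card_pair hne.symm)
    ext i
    simp only [Pi.add_apply, Pi.single_apply, Finset.mem_filter, Finset.mem_univ, true_and,
      Finset.mem_insert, Finset.mem_singleton]
    by_cases h1 : i = c
    · subst h1
      simp [hne.symm]
    · by_cases h2 : i = d
      · simp [h2, hne]
      · simp [h1, h2]
  rw [h3] at h2
  omega

theorem whiteEnd_face (z c : Fin N) (v : A.V) :
    A.whiteEnd z (A.edge (finRotate N c) (A.edge c v)) = A.rho c (A.whiteEnd z v) := by
  by_cases h : A.parity v = 0
  · rw [A.whiteEnd_of_white z h, A.whiteEnd_of_white z (by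
      rw [A.parity_edge, A.parity_edge, h]; rfl)]
    rfl
  · rw [A.whiteEnd_of_black z h, A.whiteEnd_of_black z (by
      rw [A.parity_edge, A.parity_edge, add_assoc, show (1 : ZMod 2) + 1 = 0 from rfl, add_zero]
      exact h)]
    refine Subtype.ext ?_
    change A.edge _ (A.edge _ (A.edge _ _)) = A.edge _ (A.edge _ (A.edge _ _))
    rw [A.edge_comm z, A.edge_comm z c]

/-- The white end along `z` absorbs an edge of colour `z`, so when `z` follows `c` a single edge of
colour `c` already acts as the whole `rho c`. -/
theorem whiteEnd_edge_of_finRotate_eq {z c : Fin N} (hc : finRotate N c = z) (v : A.V) :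
    A.whiteEnd z (A.edge c v) = A.rho c (A.whiteEnd z v) := by
  rw [← A.whiteEnd_face, hc, whiteEnd_edge]

end Chromotopology

/-! ### Products of disjoint transpositions -/

/-- The values of a product of disjoint transpositions. -/
theorem Equiv.Perm.prod_map_swap_apply {L : List (ℕ × ℕ)} (hL : (L.flatMap fun p => [p.1, p.2]).Nodup) :
    (∀ p ∈ L, (L.map fun p => swap p.1 p.2).prod p.1 = p.2 ∧
      (L.map fun p => swap p.1 p.2).prod p.2 = p.1) ∧
    ∀ x ∉ (L.flatMap fun p => [p.1, p.2]), (L.map fun p => swap p.1 p.2).prod x = x := by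
  induction L with
  | nil => simp
  | cons q L ih =>
    rw [List.flatMap_cons, List.nodup_append'] at hL
    obtain ⟨hq, hL, hdisj⟩ := hL
    obtain ⟨ih₁, ih₂⟩ := ih hL
    have hq1 : q.1 ∉ L.flatMap fun p => [p.1, p.2] := hdisj (by simp)
    have hq2 : q.2 ∉ L.flatMap fun p => [p.1, p.2] := hdisj (by simp)
    rw [List.map_cons, List.prod_cons]
    constructor
    · intro p hp
      rcases List.mem_cons.1 hp with rfl | hp
      · rw [Perm.mul_apply, Perm.mul_apply, ih₂ _ hq1, ih₂ _ hq2, swap_apply_left, swap_apply_right]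
        exact ⟨rfl, rfl⟩
      · have hp1 : p.1 ∈ L.flatMap fun p => [p.1, p.2] := List.mem_flatMap.2 ⟨p, hp, by simp⟩
        have hp2 : p.2 ∈ L.flatMap fun p => [p.1, p.2] := List.mem_flatMap.2 ⟨p, hp, by simp⟩
        rw [Perm.mul_apply, Perm.mul_apply, (ih₁ p hp).1, (ih₁ p hp).2]
        exact ⟨swap_apply_of_ne_of_ne (ne_of_mem_of_not_mem hp2 hq1) (ne_of_mem_of_not_mem hp2 hq2),
          swap_apply_of_ne_of_ne (ne_of_mem_of_not_mem hp1 hq1) (ne_of_mem_of_not_mem hp1 hq2)⟩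
    · intro x hx
      simp only [List.flatMap_cons, List.mem_append, List.mem_cons, List.not_mem_nil, or_false,
        not_or] at hx
      rw [Perm.mul_apply, ih₂ x hx.2, swap_apply_of_ne_of_ne hx.1.1 hx.1.2]

theorem Equiv.Perm.eq_prod_map_swap {σ : Perm ℕ} {L : List (ℕ × ℕ)}
    (hL : (L.flatMap fun p => [p.1, p.2]).Nodup) (h : ∀ p ∈ L, σ p.1 = p.2 ∧ σ p.2 = p.1)
    (hfix : ∀ x ∉ (L.flatMap fun p => [p.1, p.2]), σ x = x) :
    σ = (L.map fun p => swap p.1 p.2).prod := by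
  obtain ⟨h₁, h₂⟩ := Equiv.Perm.prod_map_swap_apply hL
  ext x
  by_cases hx : x ∈ L.flatMap fun p => [p.1, p.2]
  · obtain ⟨p, hp, hx⟩ := List.mem_flatMap.1 hx
    simp only [List.mem_cons, List.not_mem_nil, or_false] at hx
    rcases hx with rfl | rfl
    · rw [(h p hp).1, (h₁ p hp).1]
    · rw [(h p hp).2, (h₁ p hp).2]
  · rw [hfix x hx, h₂ x hx]

theorem exists_isTwoCycleDecomposition {σ : Perm ℕ} (hσ : ∀ x, σ (σ x) = x) {m : ℕ}
    (hm : ∀ x, σ x ≠ x → x ∈ Finset.Icc 1 m) : ∃ L, IsTwoCycleDecomposition σ L := by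
  -- Each 2-cycle is listed exactly once, with its smaller entry first.
  have hmem (p : ℕ × ℕ) : p ∈ ((List.range' 1 m).filter fun x => x < σ x).map (fun x => (x, σ x)) ↔
      p.1 < p.2 ∧ p.2 = σ p.1 := by
    obtain ⟨a, b⟩ := p
    simp only [List.mem_map, List.mem_filter, List.mem_range'_1, decide_eq_true_eq, Prod.mk.injEq]
    constructor
    · rintro ⟨x, ⟨-, h⟩, rfl, rfl⟩
      exact ⟨h, rfl⟩
    · rintro ⟨h, rfl⟩
      have := Finset.mem_Icc.1 (hm a h.ne')
      exact ⟨a, ⟨⟨by omega, by omega⟩, h⟩, rfl, rfl⟩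
  have hnodup : (((List.range' 1 m).filter fun x => x < σ x).flatMap fun x => [x, σ x]).Nodup := by
    rw [List.nodup_flatMap]
    constructor
    · intro x hx
      have := (List.mem_filter.1 hx).2
      simp only [decide_eq_true_eq] at this
      simpa using this.ne
    · refine List.Pairwise.imp_of_mem ?_ ((List.nodup_range' (s := 1) (n := m) (step := 1)).filter _)
      intro x y hx hy hxy a ha hb
      have h1 := (List.mem_filter.1 hx).2
      have h2 := (List.mem_filter.1 hy).2
      simp only [decide_eq_true_eq] at h1 h2
      simp only [List.mem_cons, List.not_mem_nil, or_false] at ha hb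
      rcases ha with rfl | rfl <;> rcases hb with hb | hb
      · exact hxy hb
      · rw [hb, hσ] at h1
        exact absurd h1 h2.asymm
      · rw [← hb, hσ] at h2
        exact absurd h2 h1.asymm
      · exact hxy (σ.injective hb)
  refine ⟨((List.range' 1 m).filter fun x => x < σ x).map (fun x => (x, σ x)), ?_, ?_⟩
  · rw [List.flatMap_map]
    exact hnodup
  · refine Perm.eq_prod_map_swap (by rw [List.flatMap_map]; exact hnodup) ?_ ?_
    · intro p hp
      have h := ((hmem p).1 hp).2
      exact ⟨h.symm, by rw [h, hσ]⟩
    · intro x hx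
      by_contra hne
      apply hx
      rcases lt_or_gt_of_ne hne with h | h
      · exact List.mem_flatMap.2 ⟨(σ x, x), (hmem _).2 ⟨h, (hσ x).symm⟩, by simp⟩
      · exact List.mem_flatMap.2 ⟨(x, σ x), (hmem _).2 ⟨h, rfl⟩, by simp⟩

theorem IsTwoCycleDecomposition.apply {σ : Perm ℕ} {L : List (ℕ × ℕ)}
    (h : IsTwoCycleDecomposition σ L) {p : ℕ × ℕ} (hp : p ∈ L) : σ p.1 = p.2 ∧ σ p.2 = p.1 := by
  rw [h.prod_eq]
  exact (Equiv.Perm.prod_map_swap_apply h.nodup).1 p hp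

theorem IsTwoCycleDecomposition.exists_mem {σ : Perm ℕ} {L : List (ℕ × ℕ)}
    (h : IsTwoCycleDecomposition σ L) {x : ℕ} (hx : σ x ≠ x) : ∃ p ∈ L, x = p.1 ∨ x = p.2 := by
  have : x ∈ L.flatMap fun p => [p.1, p.2] := by
    by_contra hcon
    rw [h.prod_eq] at hx
    exact hx ((Equiv.Perm.prod_map_swap_apply h.nodup).2 x hcon)
  simpa using List.mem_flatMap.1 this

/-- A permutation which is made of copies of `σ`, permuted by an involution `π`. -/
theorem IsTwoCycleDecomposition.eq_orderedProd_relabel {σ τ : Perm ℕ} {L : List (ℕ × ℕ)}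
    (hL : IsTwoCycleDecomposition σ L) {m n : ℕ} (hσ : ∀ i, i ∈ Finset.Icc 1 m ↔ σ i ≠ i)
    {f g : ℕ → ℕ → ℕ} (π : ℕ → ℕ) (hπ : ∀ J ∈ Finset.Icc 1 n, π J ∈ Finset.Icc 1 n)
    (hππ : ∀ J ∈ Finset.Icc 1 n, π (π J) = J)
    (hinj : ∀ J ∈ Finset.Icc 1 n, ∀ J' ∈ Finset.Icc 1 n, ∀ i ∈ Finset.Icc 1 m,
      ∀ i' ∈ Finset.Icc 1 m, f J i = f J' i' → J = J' ∧ i = i')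
    (hg : ∀ J ∈ Finset.Icc 1 n, ∀ i ∈ Finset.Icc 1 m, g J i = f (π J) i)
    (hτ : ∀ J ∈ Finset.Icc 1 n, ∀ i ∈ Finset.Icc 1 m, τ (f J i) = f (π J) (σ i))
    (hfix : ∀ x, (∀ J ∈ Finset.Icc 1 n, ∀ i ∈ Finset.Icc 1 m, x ≠ f J i) → τ x = x) :
    τ = orderedProd n fun J => relabel L (f J) (g J) := by
  have hn (J : ℕ) : J ∈ List.range' 1 n ↔ J ∈ Finset.Icc 1 n := by
    rw [List.mem_range'_1, Finset.mem_Icc]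
    omega
  -- No number is a first entry and also a second entry, even of different cycles. This keeps the
  -- cycles for `J` and `π J` apart although both meet the same two copies.
  have hne {p q : ℕ × ℕ} (hp : p ∈ L) (hq : q ∈ L) : p.1 ≠ q.2 := by
    obtain ⟨h₁, h₂⟩ := List.nodup_flatMap.1 hL.nodup
    have : Std.Symm fun p q : ℕ × ℕ => p.1 ≠ q.2 ∧ q.1 ≠ p.2 := ⟨fun _ _ h => h.symm⟩
    refine (List.Pairwise.forall_of_forall (R := fun p q : ℕ × ℕ => p.1 ≠ q.2 ∧ q.1 ≠ p.2)
      ?_ (h₂.imp ?_) hp hq).1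
    · intro x hx
      have := h₁ x hx
      simp only [List.nodup_cons, List.mem_singleton] at this
      exact ⟨this.1, this.1⟩
    · intro x y hxy
      exact ⟨fun h => hxy (a := x.1) (by simp) (by simp [h]),
        fun h => hxy (a := y.1) (by simp [h]) (by simp)⟩
  have hmem {p : ℕ × ℕ} (hp : p ∈ L) : p.1 ∈ Finset.Icc 1 m ∧ p.2 ∈ Finset.Icc 1 m := by
    rw [hσ, hσ, (hL.apply hp).1, (hL.apply hp).2]
    exact ⟨(hne hp hp).symm, hne hp hp⟩
  have hcommon {J J' : ℕ} (hJ : J ∈ Finset.Icc 1 n) (hJ' : J' ∈ Finset.Icc 1 n) {p q : ℕ × ℕ}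
      (hp : p ∈ L) (hq : q ∈ L) {a : ℕ} (ha : a ∈ [f J p.1, g J p.2])
      (ha' : a ∈ [f J' q.1, g J' q.2]) : J = J' ∧ (p.1 = q.1 ∨ p.2 = q.2) := by
    rw [hg J hJ _ (hmem hp).2, List.mem_pair] at ha
    rw [hg J' hJ' _ (hmem hq).2, List.mem_pair] at ha'
    rcases ha with rfl | rfl <;> rcases ha' with h | h
    · have := hinj _ hJ _ hJ' _ (hmem hp).1 _ (hmem hq).1 h
      exact ⟨this.1, Or.inl this.2⟩
    · exact (hne hp hq (hinj _ hJ _ (hπ _ hJ') _ (hmem hp).1 _ (hmem hq).2 h).2).elim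
    · exact (hne hq hp (hinj _ (hπ _ hJ) _ hJ' _ (hmem hp).2 _ (hmem hq).1 h).2.symm).elim
    · have := hinj _ (hπ _ hJ) _ (hπ _ hJ') _ (hmem hp).2 _ (hmem hq).2 h
      exact ⟨by rw [← hππ J hJ, this.1, hππ J' hJ'], Or.inr this.2⟩
  have hprod : (orderedProd n fun J => relabel L (f J) (g J)) =
      (((List.range' 1 n).flatMap fun J => L.map fun p => (f J p.1, g J p.2)).map
        fun p => swap p.1 p.2).prod := by
    rw [orderedProd, List.map_flatMap, List.flatMap_def, List.prod_flatten, List.map_map]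
    simp only [relabel, List.map_map, Function.comp_def]
  rw [hprod]
  refine Perm.eq_prod_map_swap ?_ ?_ ?_
  · simp only [List.flatMap_assoc, List.flatMap_map]
    rw [List.nodup_flatMap]
    constructor
    · intro J hJ
      rw [hn] at hJ
      rw [List.nodup_flatMap]
      constructor
      · intro p hp
        rw [hg J hJ _ (hmem hp).2, List.nodup_cons, List.mem_singleton]
        refine ⟨fun h => ?_, List.nodup_singleton _⟩
        exact hne hp hp (hinj _ hJ _ (hπ J hJ) _ (hmem hp).1 _ (hmem hp).2 h).2
      · refine List.Pairwise.imp_of_mem ?_ (List.nodup_flatMap.1 hL.nodup).2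
        intro p q hp hq hpq a ha ha'
        rcases (hcommon hJ hJ hp hq ha ha').2 with h | h
        · exact hpq (a := p.1) (by simp) (by simp [h])
        · exact hpq (a := p.2) (by simp) (by simp [h])
    · refine List.Pairwise.imp_of_mem ?_ (List.nodup_range' (s := 1) (n := n) (step := 1))
      intro J J' hJ hJ' hne' a ha ha'
      obtain ⟨p, hp, ha⟩ := List.mem_flatMap.1 ha
      obtain ⟨q, hq, ha'⟩ := List.mem_flatMap.1 ha'
      exact hne' (hcommon ((hn J).1 hJ) ((hn J').1 hJ') hp hq ha ha').1
  · intro p hp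
    obtain ⟨J, hJ, hp⟩ := List.mem_flatMap.1 hp
    obtain ⟨q, hq, rfl⟩ := List.mem_map.1 hp
    rw [hn] at hJ
    have hq' := hmem hq
    refine ⟨?_, ?_⟩
    · rw [hτ J hJ _ hq'.1, (hL.apply hq).1, hg J hJ _ hq'.2]
    · rw [hg J hJ _ hq'.2, hτ _ (hπ J hJ) _ hq'.2, (hL.apply hq).2, hππ J hJ]
  · intro x hx
    refine hfix x ?_
    rintro J hJ i hi rfl
    apply hx
    -- A first entry in copy `J` occurs in a cycle indexed by `J`, a second entry in one indexed by
    -- `π J`. Using the same order of entries for all `J` makes this exhaustive.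
    obtain ⟨p, hp, rfl | rfl⟩ := hL.exists_mem ((hσ i).1 hi)
    · refine List.mem_flatMap.2 ⟨(f J p.1, g J p.2),
        List.mem_flatMap.2 ⟨J, (hn J).2 hJ, List.mem_map.2 ⟨p, hp, rfl⟩⟩, by simp⟩
    · refine List.mem_flatMap.2 ⟨(f (π J) p.1, g (π J) p.2),
        List.mem_flatMap.2 ⟨π J, (hn _).2 (hπ J hJ), List.mem_map.2 ⟨p, hp, rfl⟩⟩, ?_⟩
      rw [hg _ (hπ J hJ) _ hi, hππ J hJ]
      simp

/-! ### Arithmetic of the labels -/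

/-- The label of the white vertex of a tensor product with coordinates `i`, `j` in the factors and
parity `b` in the second factor. -/
def tensorLabel (m i j : ℕ) (b : ZMod 2) : ℕ := (2 * (j - 1) + b.val) * m + i

theorem mul_add_inj_of_mem_Icc {m a a' i i' : ℕ} (hi : i ∈ Finset.Icc 1 m)
    (hi' : i' ∈ Finset.Icc 1 m) (h : a * m + i = a' * m + i') : a = a' ∧ i = i' := by
  rw [Finset.mem_Icc] at hi hi'
  obtain rfl : a = a' := by
    rcases lt_trichotomy a a' with hlt | rfl | hlt
    · have := Nat.mul_le_mul_right m (Nat.succ_le_of_lt hlt)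
      rw [Nat.succ_mul] at this
      omega
    · rfl
    · have := Nat.mul_le_mul_right m (Nat.succ_le_of_lt hlt)
      rw [Nat.succ_mul] at this
      omega
  exact ⟨rfl, by omega⟩

theorem tensorLabel_inj {m n i i' j j' : ℕ} {b b' : ZMod 2} (hi : i ∈ Finset.Icc 1 m)
    (hi' : i' ∈ Finset.Icc 1 m) (hj : j ∈ Finset.Icc 1 n) (hj' : j' ∈ Finset.Icc 1 n)
    (h : tensorLabel m i j b = tensorLabel m i' j' b') : i = i' ∧ j = j' ∧ b = b' := by
  obtain ⟨h₁, h₂⟩ := mul_add_inj_of_mem_Icc hi hi' h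
  rw [Finset.mem_Icc] at hj hj'
  have := b.val_lt
  have := b'.val_lt
  exact ⟨h₂, by omega, ZMod.val_injective 2 (by omega)⟩

theorem tensorLabel_mem {m n i j : ℕ} (b : ZMod 2) (hi : i ∈ Finset.Icc 1 m)
    (hj : j ∈ Finset.Icc 1 n) : tensorLabel m i j b ∈ Finset.Icc 1 (2 * n * m) := by
  rw [Finset.mem_Icc] at hi hj ⊢
  have hb := b.val_lt
  have := Nat.mul_le_mul_right m (show 2 * (j - 1) + b.val + 1 ≤ 2 * n by omega)
  rw [Nat.succ_mul] at this
  rw [tensorLabel]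
  omega

theorem eq_zero_or_one (b : ZMod 2) : b = 0 ∨ b = 1 := by revert b; decide

/-- The copies `J`, `partner J` of the first factor in terms of coordinates. -/
theorem exists_tensorLabel_left {n J : ℕ} (hJ : J ∈ Finset.Icc 1 (2 * n)) :
    ∃ j ∈ Finset.Icc 1 n, ∃ b : ZMod 2, ∀ m i, (J - 1) * m + i = tensorLabel m i j b ∧
      (partner J - 1) * m + i = tensorLabel m i j (b + 1) := by
  rw [Finset.mem_Icc] at hJ
  -- From `J - 1 = 2(j - 1) + b`, odd copies have `b = 0` and even copies `b = 1`.
  by_cases h : Odd J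
  · obtain ⟨a, rfl⟩ := h
    refine ⟨a + 1, Finset.mem_Icc.2 (by omega), 0, fun m i => ?_⟩
    simp [tensorLabel, partner, ZMod.val_one]
  · obtain ⟨a, rfl⟩ := Nat.not_odd_iff_even.1 h
    refine ⟨a, Finset.mem_Icc.2 (by omega), 1, fun m i => ?_⟩
    rw [partner, if_neg h, tensorLabel, tensorLabel, show (1 : ZMod 2) + 1 = 0 from rfl,
      ZMod.val_one, ZMod.val_zero]
    constructor <;> congr 2 <;> omega

theorem tensorLabel_eq_left {n j : ℕ} (hj : j ∈ Finset.Icc 1 n) (b : ZMod 2) :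
    ∃ J ∈ Finset.Icc 1 (2 * n), ∀ m i, tensorLabel m i j b = (J - 1) * m + i := by
  rw [Finset.mem_Icc] at hj
  have := b.val_lt
  exact ⟨2 * (j - 1) + b.val + 1, Finset.mem_Icc.2 (by omega), fun m i => rfl⟩

theorem partner_mem {n J : ℕ} (hJ : J ∈ Finset.Icc 1 (2 * n)) :
    partner J ∈ Finset.Icc 1 (2 * n) := by
  rw [Finset.mem_Icc] at hJ ⊢
  rw [partner]
  split_ifs with h
  · obtain ⟨a, rfl⟩ := h
    omega
  · obtain ⟨a, rfl⟩ := Nat.not_odd_iff_even.1 h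
    omega

theorem partner_partner {J : ℕ} (hJ : 1 ≤ J) : partner (partner J) = J := by
  by_cases h : Odd J
  · rw [partner, partner, if_pos h, if_neg (by rw [Nat.not_odd_iff_even]; exact h.add_one)]
    rfl
  · have h' : Odd (J - 1) := Nat.Even.sub_odd hJ (Nat.not_odd_iff_even.1 h) odd_one
    rw [partner, partner, if_neg h, if_pos h']
    omega

/-- The pairing of `1, …, m` with `m + 1, …, 2 * m`. -/
def halfSwap (m I : ℕ) : ℕ := if I ≤ m then I + m else I - m

theorem halfSwap_mem {m I : ℕ} (hI : I ∈ Finset.Icc 1 (2 * m)) :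
    halfSwap m I ∈ Finset.Icc 1 (2 * m) := by
  rw [Finset.mem_Icc] at hI ⊢
  rw [halfSwap]
  split_ifs <;> omega

theorem halfSwap_halfSwap {m I : ℕ} (hI : I ∈ Finset.Icc 1 (2 * m)) :
    halfSwap m (halfSwap m I) = I := by
  rw [Finset.mem_Icc] at hI
  rw [halfSwap, halfSwap]
  split_ifs <;> omega

/-- The subtraction is exact in the second case because `I > m`; this matches the signed shift in
the main statement. -/
theorem add_halfSwap (m I a : ℕ) :
    a + halfSwap m I = if I ≤ m then a + I + m else a + I - m := by
  rw [halfSwap]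
  split_ifs <;> omega

/-- The copies `I`, `halfSwap m I` of the second factor in terms of coordinates. -/
theorem exists_tensorLabel_right {m I : ℕ} (hI : I ∈ Finset.Icc 1 (2 * m)) :
    ∃ i ∈ Finset.Icc 1 m, ∃ b : ZMod 2, ∀ j, (j - 1) * (2 * m) + I = tensorLabel m i j b ∧
      (j - 1) * (2 * m) + halfSwap m I = tensorLabel m i j (b + 1) := by
  rw [Finset.mem_Icc] at hI
  rw [halfSwap]
  -- Here `I = b * m + i`, so the half in which `I` lies is the parity `b`.
  split_ifs with h
  · refine ⟨I, Finset.mem_Icc.2 ⟨hI.1, h⟩, 0, fun j => ?_⟩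
    rw [tensorLabel, tensorLabel, zero_add, ZMod.val_one, ZMod.val_zero]
    constructor <;> ring
  · obtain ⟨i, rfl⟩ := Nat.exists_eq_add_of_lt (not_le.1 h)
    refine ⟨i + 1, Finset.mem_Icc.2 (by omega), 1, fun j => ?_⟩
    rw [tensorLabel, tensorLabel, show (1 : ZMod 2) + 1 = 0 from rfl,
      ZMod.val_one, ZMod.val_zero, show m + i + 1 - m = i + 1 by omega]
    constructor <;> ring

theorem tensorLabel_eq_right {m i : ℕ} (hi : i ∈ Finset.Icc 1 m) (b : ZMod 2) :
    ∃ I ∈ Finset.Icc 1 (2 * m), ∀ j, tensorLabel m i j b = (j - 1) * (2 * m) + I := by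
  rw [Finset.mem_Icc] at hi
  rcases eq_zero_or_one b with rfl | rfl
  · refine ⟨i, Finset.mem_Icc.2 (by omega), fun j => ?_⟩
    rw [tensorLabel, ZMod.val_zero]
    ring
  · refine ⟨i + m, Finset.mem_Icc.2 (by omega), fun j => ?_⟩
    rw [tensorLabel, ZMod.val_one]
    ring

/-! ### The code of the tensor product -/

namespace Chromotopology

section TensorCode

variable {N₁ N₂ : ℕ} (C₁ : Submodule (ZMod 2) (Fin N₁ → ZMod 2))
  (C₂ : Submodule (ZMod 2) (Fin N₂ → ZMod 2))

/-- The projection of the `(N₁ + N₂)`-cube to the product of two quotients of cubes. -/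
def tensorMap : (Fin (N₁ + N₂) → ZMod 2) →ₗ[ZMod 2]
    ((Fin N₁ → ZMod 2) ⧸ C₁) × ((Fin N₂ → ZMod 2) ⧸ C₂) :=
  (C₁.mkQ ∘ₗ LinearMap.funLeft (ZMod 2) (ZMod 2) (Fin.castAdd N₂)).prod
    (C₂.mkQ ∘ₗ LinearMap.funLeft (ZMod 2) (ZMod 2) (Fin.natAdd N₁))

theorem tensorMap_apply (x : Fin (N₁ + N₂) → ZMod 2) :
    tensorMap C₁ C₂ x = (C₁.mkQ fun i => x (Fin.castAdd N₂ i), C₂.mkQ fun i => x (Fin.natAdd N₁ i)) :=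
  rfl

theorem tensorMap_surjective : Function.Surjective (tensorMap C₁ C₂) := by
  rintro ⟨v₁, v₂⟩
  obtain ⟨x₁, rfl⟩ := C₁.mkQ_surjective v₁
  obtain ⟨x₂, rfl⟩ := C₂.mkQ_surjective v₂
  refine ⟨Fin.append x₁ x₂, ?_⟩
  simp [tensorMap_apply]

theorem finrank_ker_tensorMap : Module.finrank (ZMod 2) (LinearMap.ker (tensorMap C₁ C₂)) =
    Module.finrank (ZMod 2) C₁ + Module.finrank (ZMod 2) C₂ := by
  have h := LinearMap.finrank_range_add_finrank_ker (tensorMap C₁ C₂)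
  rw [LinearMap.range_eq_top.2 (tensorMap_surjective C₁ C₂), finrank_top, Module.finrank_prod,
    Module.finrank_fin_fun] at h
  have h₁ := C₁.finrank_quotient_add_finrank
  have h₂ := C₂.finrank_quotient_add_finrank
  rw [Module.finrank_fin_fun] at h₁ h₂
  omega

theorem hammingNorm_append (x : Fin (N₁ + N₂) → ZMod 2) :
    hammingNorm x = hammingNorm (fun i => x (Fin.castAdd N₂ i)) +
      hammingNorm fun i => x (Fin.natAdd N₁ i) := by
  simp only [hammingNorm, Finset.card_filter, Fin.sum_univ_add]

variable {C₁ C₂}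

theorem doublyEven_ker_tensorMap (h₁ : DoublyEven C₁) (h₂ : DoublyEven C₂) :
    DoublyEven (LinearMap.ker (tensorMap C₁ C₂)) := by
  intro x hx
  rw [LinearMap.mem_ker, tensorMap_apply, Prod.mk_eq_zero, Submodule.mkQ_apply, Submodule.mkQ_apply,
    Submodule.Quotient.mk_eq_zero, Submodule.Quotient.mk_eq_zero] at hx
  rw [hammingNorm_append]
  exact dvd_add (h₁ _ hx.1) (h₂ _ hx.2)

theorem tensor_edge_tensorMap (h₁ : DoublyEven C₁) (h₂ : DoublyEven C₂) (c : Fin (N₁ + N₂))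
    (x : Fin (N₁ + N₂) → ZMod 2) :
    ((ofCode C₁ h₁).tensor (ofCode C₂ h₂)).edge c (tensorMap C₁ C₂ x) =
      tensorMap C₁ C₂ (x + Pi.single c 1) := by
  have hzero {n : ℕ} (C : Submodule (ZMod 2) (Fin n → ZMod 2)) (y z : Fin n → ZMod 2) (hz : z = 0) :
      C.mkQ y = C.mkQ (y + z) := by rw [hz, add_zero]
  have hone {n : ℕ} (C : Submodule (ZMod 2) (Fin n → ZMod 2)) (y z z' : Fin n → ZMod 2)
      (hz : z = z') : C.mkQ y + C.mkQ z' = C.mkQ (y + z) := by rw [hz, map_add]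
  refine Fin.addCases (fun c => ?_) (fun c => ?_) c
  · refine (tensor_edge_castAdd _ _ c _).trans (Prod.ext (hone C₁ _ _ _ ?_) (hzero C₂ _ _ ?_))
    · funext i
      simp [Pi.single_apply]
    · funext i
      refine Pi.single_eq_of_ne ?_ _
      simp [Fin.ext_iff]
      omega
  · refine (tensor_edge_natAdd _ _ c _).trans (Prod.ext (hzero C₁ _ _ ?_) (hone C₂ _ _ _ ?_))
    · funext i
      refine Pi.single_eq_of_ne ?_ _
      simp [Fin.ext_iff]
      omega
    · funext i
      simp [Pi.single_apply]

theorem quotKerEquiv_tensorMap_symm (x : Fin (N₁ + N₂) → ZMod 2) :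
    ((tensorMap C₁ C₂).quotKerEquivOfSurjective (tensorMap_surjective C₁ C₂)).symm
      (tensorMap C₁ C₂ x) = Submodule.Quotient.mk x :=
  (LinearEquiv.symm_apply_eq _).2 (LinearMap.quotKerEquivOfSurjective_apply_mk _ _ _).symm

/-- The tensor product of two quotients of cubes is a quotient of a cube. -/
def tensorIso (h₁ : DoublyEven C₁) (h₂ : DoublyEven C₂) :
    ((ofCode C₁ h₁).tensor (ofCode C₂ h₂)).Iso (ofCode _ (doublyEven_ker_tensorMap h₁ h₂)) where
  toEquiv := ((tensorMap C₁ C₂).quotKerEquivOfSurjective (tensorMap_surjective C₁ C₂)).symm.toEquiv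
  map_edge c v := by
    obtain ⟨x, rfl⟩ := tensorMap_surjective C₁ C₂ v
    rw [tensor_edge_tensorMap]
    refine (quotKerEquiv_tensorMap_symm _).trans ?_
    exact (congrArg ((ofCode _ (doublyEven_ker_tensorMap h₁ h₂)).edge c)
      (quotKerEquiv_tensorMap_symm x)).symm
  map_parity v := by
    obtain ⟨x, rfl⟩ := tensorMap_surjective C₁ C₂ v
    refine (congrArg (ofCode _ (doublyEven_ker_tensorMap h₁ h₂)).parity
      (quotKerEquiv_tensorMap_symm x)).trans ?_
    change weightParity _ x = weightParity _ _ + weightParity _ _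
    simp [weightParity, Fin.sum_univ_add, LinearMap.funLeft_apply]

end TensorCode

/-- The white vertices of isomorphic chromotopologies. -/
def Iso.whiteEquiv {N : ℕ} {A B : Chromotopology N} (e : A.Iso B) : A.White ≃ B.White :=
  e.toEquiv.subtypeEquiv fun v => by rw [e.map_parity]

/-! ### Face permutations acting on labels -/

section Labels

variable {N : ℕ} {A : Chromotopology N} {m : ℕ} (l : A.Labeling m)

theorem labeledRho_label (c : Fin N) (w : A.White) :
    labeledRho l c (l w : ℕ) = (l (A.rho c w) : ℕ) :=
  Perm.extendDomain_apply_image _ _ _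

theorem exists_label_eq {i : ℕ} (hi : i ∈ Finset.Icc 1 m) : ∃ w, (l w : ℕ) = i :=
  ⟨l.symm ⟨i, hi⟩, by rw [Equiv.apply_symm_apply]⟩

theorem labeledRho_of_notMem (c : Fin N) {x : ℕ} (hx : x ∉ Finset.Icc 1 m) :
    labeledRho l c x = x :=
  Perm.extendDomain_apply_not_subtype _ _ hx

theorem labeledRho_labeledRho (c : Fin N) (x : ℕ) : labeledRho l c (labeledRho l c x) = x := by
  by_cases hx : x ∈ Finset.Icc 1 m
  · obtain ⟨w, rfl⟩ := exists_label_eq l hx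
    rw [labeledRho_label, labeledRho_label, rho_rho]
  · rw [labeledRho_of_notMem l c hx, labeledRho_of_notMem l c hx]

theorem exists_isTwoCycleDecomposition_labeledRho (c : Fin N) :
    ∃ L, IsTwoCycleDecomposition (labeledRho l c) L :=
  exists_isTwoCycleDecomposition (labeledRho_labeledRho l c) fun _ hx =>
    by_contra fun h => hx (labeledRho_of_notMem l c h)

/-- Without fixed points the support is the whole set of labels, so every label appears in any cycle
decomposition. -/
theorem mem_Icc_iff_labeledRho_ne {c : Fin N} (hc : ∀ w, A.rho c w ≠ w) (i : ℕ) :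
    i ∈ Finset.Icc 1 m ↔ labeledRho l c i ≠ i := by
  refine ⟨fun hi => ?_, fun h => by_contra fun hi => h (labeledRho_of_notMem l c hi)⟩
  obtain ⟨w, rfl⟩ := exists_label_eq l hi
  rw [labeledRho_label]
  exact fun h => hc w (l.injective (Subtype.ext h))

end Labels

/-! ### Face permutations of the tensor product in coordinates -/

section TensorLabels

variable {N₁ N₂ : ℕ} {A₁ : Chromotopology N₁} {A₂ : Chromotopology N₂} {m₁ m₂ M : ℕ}

/-- The label in the tensor product agrees with the coordinates: the labels in the factors of the
white ends of the edges of the first colours, and the parity in the second factor. -/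
def IsTensorLabeling (z₁ : Fin N₁) (z₂ : Fin N₂) (l₁ : A₁.Labeling m₁) (l₂ : A₂.Labeling m₂)
    (l : (A₁.tensor A₂).Labeling M) : Prop :=
  ∀ (w : (A₁.tensor A₂).White) (v₁ : A₁.V) (v₂ : A₂.V), w.1 = (v₁, v₂) →
    (l w : ℕ) =
      tensorLabel m₁ (l₁ (A₁.whiteEnd z₁ v₁)) (l₂ (A₂.whiteEnd z₂ v₂)) (A₂.parity v₂)

theorem exists_isTensorLabeling (z₁ : Fin N₁) (z₂ : Fin N₂) (l₁ : A₁.Labeling m₁)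
    (l₂ : A₂.Labeling m₂) (hM : M = 2 * m₂ * m₁) (hcard : Nat.card (A₁.tensor A₂).White = M) :
    ∃ l : (A₁.tensor A₂).Labeling M, IsTensorLabeling z₁ z₂ l₁ l₂ l := by
  let F : (A₁.tensor A₂).White → {i : ℕ // i ∈ Finset.Icc 1 M} := fun w =>
    ⟨tensorLabel m₁ (l₁ (A₁.whiteEnd z₁ w.1.1)) (l₂ (A₂.whiteEnd z₂ w.1.2)) (A₂.parity w.1.2),
      hM ▸ tensorLabel_mem _ (l₁ _).2 (l₂ _).2⟩
  have hF : Function.Injective F := by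
    rintro ⟨⟨v₁, v₂⟩, h⟩ ⟨⟨u₁, u₂⟩, h'⟩ hvu
    obtain ⟨e₁, e₂, e₃⟩ := tensorLabel_inj (l₁ _).2 (l₁ _).2 (l₂ _).2 (l₂ _).2
      (congrArg Subtype.val hvu)
    replace e₁ := l₁.injective (Subtype.ext e₁)
    replace e₂ := l₂.injective (Subtype.ext e₂)
    -- The label of the white end and the parity recover `v₂`. Whiteness of the pair then fixes the
    -- parity of `v₁`, which is therefore not recorded in the label.
    have h₂ : v₂ = u₂ := (A₂.whiteEndEquiv z₂).injective (Prod.ext e₂ e₃)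
    have h : A₁.parity v₁ + A₂.parity v₂ = 0 := h
    have h' : A₁.parity u₁ + A₂.parity u₂ = 0 := h'
    have h₁ : v₁ = u₁ := (A₁.whiteEndEquiv z₁).injective (Prod.ext e₁ (by
      change A₁.parity v₁ = A₁.parity u₁
      rw [eq_neg_of_add_eq_zero_left h, eq_neg_of_add_eq_zero_left h', h₂]))
    subst h₁ h₂
    rfl
  have hbij : Function.Bijective F :=
    hF.bijective_of_nat_card_le (by rw [hcard, Nat.card_eq_fintype_card, Fintype.card_coe, Nat.card_Icc]; rfl)
  exact ⟨Equiv.ofBijective F hbij, by rintro w v₁ v₂ h; obtain ⟨_, hw⟩ := w; subst h; rfl⟩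

variable {z₁ : Fin N₁} {z₂ : Fin N₂} {l₁ : A₁.Labeling m₁} {l₂ : A₂.Labeling m₂}
  {l : (A₁.tensor A₂).Labeling M}

theorem exists_vertex_of_coordinates (z₁ : Fin N₁) (z₂ : Fin N₂) (l₁ : A₁.Labeling m₁)
    (l₂ : A₂.Labeling m₂) {i j : ℕ} (hi : i ∈ Finset.Icc 1 m₁) (hj : j ∈ Finset.Icc 1 m₂)
    (b : ZMod 2) : ∃ (w : (A₁.tensor A₂).White) (v₁ : A₁.V) (v₂ : A₂.V), w.1 = (v₁, v₂) ∧
      (l₁ (A₁.whiteEnd z₁ v₁) : ℕ) = i ∧ (l₂ (A₂.whiteEnd z₂ v₂) : ℕ) = j ∧ A₂.parity v₂ = b := by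
  obtain ⟨w₁, rfl⟩ := exists_label_eq l₁ hi
  obtain ⟨w₂, rfl⟩ := exists_label_eq l₂ hj
  obtain ⟨v₁, hv₁⟩ := (A₁.whiteEndEquiv z₁).surjective (w₁, b)
  obtain ⟨v₂, hv₂⟩ := (A₂.whiteEndEquiv z₂).surjective (w₂, b)
  have a₁ : A₁.whiteEnd z₁ v₁ = w₁ := congrArg Prod.fst hv₁
  have b₁ : A₁.parity v₁ = b := congrArg Prod.snd hv₁
  have a₂ : A₂.whiteEnd z₂ v₂ = w₂ := congrArg Prod.fst hv₂
  have b₂ : A₂.parity v₂ = b := congrArg Prod.snd hv₂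
  refine ⟨⟨(v₁, v₂), ?_⟩, v₁, v₂, rfl, by rw [a₁], by rw [a₂], b₂⟩
  change A₁.parity v₁ + A₂.parity v₂ = 0
  rw [b₁, b₂]
  exact CharTwo.add_self_eq_zero b

theorem IsTensorLabeling.exists_coordinates (hl : IsTensorLabeling z₁ z₂ l₁ l₂ l) {x : ℕ}
    (hx : x ∈ Finset.Icc 1 M) : ∃ i ∈ Finset.Icc 1 m₁, ∃ j ∈ Finset.Icc 1 m₂, ∃ b,
      x = tensorLabel m₁ i j b := by
  obtain ⟨w, rfl⟩ := exists_label_eq l hx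
  exact ⟨_, (l₁ _).2, _, (l₂ _).2, _, hl w w.1.1 w.1.2 rfl⟩

/-- Common form of the four cases below: `f₁`, `f₂` are the moves in the factors, `s₁`, `s₂` their
effects on the labels of white ends, and `t` the change of parity in the second factor. -/
theorem IsTensorLabeling.labeledRho_tensorLabel (hl : IsTensorLabeling z₁ z₂ l₁ l₂ l)
    {c : Fin (N₁ + N₂)} {f₁ : A₁.V → A₁.V} {f₂ : A₂.V → A₂.V} {s₁ s₂ : ℕ → ℕ} {t : ZMod 2}
    (hc : ∀ v₁ v₂, (A₁.tensor A₂).edge (finRotate _ c) ((A₁.tensor A₂).edge c (v₁, v₂)) =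
      (f₁ v₁, f₂ v₂))
    (h₁ : ∀ v, (l₁ (A₁.whiteEnd z₁ (f₁ v)) : ℕ) = s₁ (l₁ (A₁.whiteEnd z₁ v)))
    (h₂ : ∀ v, (l₂ (A₂.whiteEnd z₂ (f₂ v)) : ℕ) = s₂ (l₂ (A₂.whiteEnd z₂ v)))
    (ht : ∀ v, A₂.parity (f₂ v) = A₂.parity v + t) {i j : ℕ} (hi : i ∈ Finset.Icc 1 m₁)
    (hj : j ∈ Finset.Icc 1 m₂) (b : ZMod 2) :
    labeledRho l c (tensorLabel m₁ i j b) = tensorLabel m₁ (s₁ i) (s₂ j) (b + t) := by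
  obtain ⟨w, v₁, v₂, hw, rfl, rfl, rfl⟩ := exists_vertex_of_coordinates z₁ z₂ l₁ l₂ hi hj b
  rw [← hl w v₁ v₂ hw, labeledRho_label, ← h₁, ← h₂, ← ht]
  refine hl _ _ _ ?_
  rw [rho_val, hw, hc]

theorem IsTensorLabeling.castAdd_of_lt (hl : IsTensorLabeling z₁ z₂ l₁ l₂ l) {c : Fin N₁}
    (hc : (c : ℕ) + 1 < N₁) {i j : ℕ} (hi : i ∈ Finset.Icc 1 m₁) (hj : j ∈ Finset.Icc 1 m₂)
    (b : ZMod 2) : labeledRho l (Fin.castAdd N₂ c) (tensorLabel m₁ i j b) =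
      tensorLabel m₁ (labeledRho l₁ c i) j b := by
  have hrot : finRotate (N₁ + N₂) (Fin.castAdd N₂ c) = Fin.castAdd N₂ (finRotate N₁ c) := by
    rw [finRotate_of_succ_lt hc, finRotate_of_succ_lt (by simp; omega)]
    rfl
  have := hl.labeledRho_tensorLabel (c := Fin.castAdd N₂ c) (s₁ := labeledRho l₁ c) (s₂ := id)
    (t := 0) (f₁ := fun v => A₁.edge (finRotate N₁ c) (A₁.edge c v)) (f₂ := id)
    (fun v₁ v₂ => by rw [hrot, tensor_edge_castAdd, tensor_edge_castAdd]; rfl)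
    (fun v => by rw [labeledRho_label, whiteEnd_face]) (fun v => rfl) (fun v => (add_zero _).symm)
    hi hj b
  rwa [add_zero] at this

theorem IsTensorLabeling.natAdd_of_lt (hl : IsTensorLabeling z₁ z₂ l₁ l₂ l) {c : Fin N₂}
    (hc : (c : ℕ) + 1 < N₂) {i j : ℕ} (hi : i ∈ Finset.Icc 1 m₁) (hj : j ∈ Finset.Icc 1 m₂)
    (b : ZMod 2) : labeledRho l (Fin.natAdd N₁ c) (tensorLabel m₁ i j b) =
      tensorLabel m₁ i (labeledRho l₂ c j) b := by
  have hrot : finRotate (N₁ + N₂) (Fin.natAdd N₁ c) = Fin.natAdd N₁ (finRotate N₂ c) := by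
    rw [finRotate_of_succ_lt hc, finRotate_of_succ_lt (by simp; omega)]
    rfl
  have := hl.labeledRho_tensorLabel (c := Fin.natAdd N₁ c) (s₁ := id) (s₂ := labeledRho l₂ c)
    (t := 0) (f₁ := id) (f₂ := fun v => A₂.edge (finRotate N₂ c) (A₂.edge c v))
    (fun v₁ v₂ => by rw [hrot, tensor_edge_natAdd, tensor_edge_natAdd]; rfl)
    (fun v => rfl) (fun v => by rw [labeledRho_label, whiteEnd_face])
    (fun v => by rw [A₂.parity_edge, A₂.parity_edge, add_assoc]; rfl) hi hj b
  rwa [add_zero] at this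

/-- The last colour of `A₁` is followed by the first colour of `A₂`. The former acts on `i` as a
full `rho`, since `z₁` is its cyclic successor; the latter keeps `j` and flips `b`. -/
theorem IsTensorLabeling.castAdd_last (hl : IsTensorLabeling z₁ z₂ l₁ l₂ l) (hz₁ : (z₁ : ℕ) = 0)
    (hz₂ : (z₂ : ℕ) = 0) {c : Fin N₁} (hc : (c : ℕ) + 1 = N₁) {i j : ℕ}
    (hi : i ∈ Finset.Icc 1 m₁) (hj : j ∈ Finset.Icc 1 m₂) (b : ZMod 2) :
    labeledRho l (Fin.castAdd N₂ c) (tensorLabel m₁ i j b) =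
      tensorLabel m₁ (labeledRho l₁ c i) j (b + 1) := by
  have hN₂ := z₂.pos
  have hrot : finRotate (N₁ + N₂) (Fin.castAdd N₂ c) = Fin.natAdd N₁ z₂ := by
    rw [finRotate_of_succ_lt (by simp; omega)]
    ext
    simp [hc, hz₂]
  have hrot₁ : finRotate N₁ c = z₁ := by
    rw [finRotate_of_succ_eq c.pos hc]
    exact Fin.ext hz₁.symm
  exact hl.labeledRho_tensorLabel (c := Fin.castAdd N₂ c) (s₁ := labeledRho l₁ c) (s₂ := id)
    (f₁ := A₁.edge c) (f₂ := A₂.edge z₂)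
    (fun v₁ v₂ => by rw [hrot, tensor_edge_castAdd, tensor_edge_natAdd])
    (fun v => by rw [labeledRho_label, whiteEnd_edge_of_finRotate_eq A₁ hrot₁])
    (fun v => by rw [whiteEnd_edge]; rfl) (fun v => A₂.parity_edge _ _) hi hj b

/-- The rainbow wraps around to the first colour of `A₁`, so the roles of the two factors are
exchanged. -/
theorem IsTensorLabeling.natAdd_last (hl : IsTensorLabeling z₁ z₂ l₁ l₂ l) (hz₁ : (z₁ : ℕ) = 0)
    (hz₂ : (z₂ : ℕ) = 0) {c : Fin N₂} (hc : (c : ℕ) + 1 = N₂) {i j : ℕ}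
    (hi : i ∈ Finset.Icc 1 m₁) (hj : j ∈ Finset.Icc 1 m₂) (b : ZMod 2) :
    labeledRho l (Fin.natAdd N₁ c) (tensorLabel m₁ i j b) =
      tensorLabel m₁ i (labeledRho l₂ c j) (b + 1) := by
  have hrot : finRotate (N₁ + N₂) (Fin.natAdd N₁ c) = Fin.castAdd N₂ z₁ := by
    rw [finRotate_of_succ_eq (Nat.add_pos_left z₁.pos _) (by simp; omega)]
    ext
    simp [hz₁]
  have hrot₂ : finRotate N₂ c = z₂ := by
    rw [finRotate_of_succ_eq c.pos hc]
    exact Fin.ext hz₂.symm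
  exact hl.labeledRho_tensorLabel (c := Fin.natAdd N₁ c) (s₁ := id) (s₂ := labeledRho l₂ c)
    (f₁ := A₁.edge z₁) (f₂ := A₂.edge c)
    (fun v₁ v₂ => by rw [hrot, tensor_edge_natAdd, tensor_edge_castAdd])
    (fun v => by rw [whiteEnd_edge]; rfl)
    (fun v => by rw [labeledRho_label, whiteEnd_edge_of_finRotate_eq A₂ hrot₂])
    (fun v => A₂.parity_edge _ _) hi hj b

end TensorLabels

/-! ### Cycle decompositions in the tensor product -/

section TensorDecomposition

variable {N₁ N₂ : ℕ} {A₁ : Chromotopology N₁} {A₂ : Chromotopology N₂} {m₁ m₂ M : ℕ}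
  {z₁ : Fin N₁} {z₂ : Fin N₂} {l₁ : A₁.Labeling m₁} {l₂ : A₂.Labeling m₂}
  {l : (A₁.tensor A₂).Labeling M} {L : List (ℕ × ℕ)}

/-- A permutation of the white vertices of the tensor product which acts by `rho c` on the first
factor and permutes the copies of the first factor. -/
theorem IsTensorLabeling.eq_orderedProd_left (hl : IsTensorLabeling z₁ z₂ l₁ l₂ l) {c : Fin N₁}
    (hc : ∀ w, A₁.rho c w ≠ w) (hL : IsTwoCycleDecomposition (labeledRho l₁ c) L)
    {d : Fin (N₁ + N₂)} {π : ℕ → ℕ} (hπ : ∀ J ∈ Finset.Icc 1 (2 * m₂), π J ∈ Finset.Icc 1 (2 * m₂))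
    (hππ : ∀ J ∈ Finset.Icc 1 (2 * m₂), π (π J) = J)
    (h : ∀ J ∈ Finset.Icc 1 (2 * m₂), ∀ i ∈ Finset.Icc 1 m₁,
      labeledRho l d ((J - 1) * m₁ + i) = (π J - 1) * m₁ + labeledRho l₁ c i) :
    labeledRho l d = orderedProd (2 * m₂) fun J =>
      relabel L (fun i => (J - 1) * m₁ + i) (fun i => (π J - 1) * m₁ + i) := by
  refine hL.eq_orderedProd_relabel (mem_Icc_iff_labeledRho_ne l₁ hc) π hπ hππ ?_
    (fun _ _ _ _ => rfl) h ?_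
  · intro J hJ J' hJ' i hi i' hi' h
    have := mul_add_inj_of_mem_Icc hi hi' h
    rw [Finset.mem_Icc] at hJ hJ'
    omega
  · intro x hx
    refine labeledRho_of_notMem l d fun hmem => ?_
    obtain ⟨i, hi, j, hj, b, rfl⟩ := hl.exists_coordinates hmem
    obtain ⟨J, hJ, h⟩ := tensorLabel_eq_left hj b
    exact hx J hJ i hi (h m₁ i)

/-- A permutation of the white vertices of the tensor product which acts by `rho c` on the second
factor and permutes the copies of the second factor. -/
theorem IsTensorLabeling.eq_orderedProd_right (hl : IsTensorLabeling z₁ z₂ l₁ l₂ l) {c : Fin N₂}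
    (hc : ∀ w, A₂.rho c w ≠ w) (hL : IsTwoCycleDecomposition (labeledRho l₂ c) L)
    {d : Fin (N₁ + N₂)} {π : ℕ → ℕ} (hπ : ∀ I ∈ Finset.Icc 1 (2 * m₁), π I ∈ Finset.Icc 1 (2 * m₁))
    (hππ : ∀ I ∈ Finset.Icc 1 (2 * m₁), π (π I) = I) {g : ℕ → ℕ → ℕ}
    (hg : ∀ I j, g I j = (j - 1) * (2 * m₁) + π I)
    (h : ∀ I ∈ Finset.Icc 1 (2 * m₁), ∀ j ∈ Finset.Icc 1 m₂,
      labeledRho l d ((j - 1) * (2 * m₁) + I) = (labeledRho l₂ c j - 1) * (2 * m₁) + π I) :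
    labeledRho l d = orderedProd (2 * m₁) fun I =>
      relabel L (fun j => (j - 1) * (2 * m₁) + I) (g I) := by
  refine hL.eq_orderedProd_relabel (f := fun I j => (j - 1) * (2 * m₁) + I)
    (mem_Icc_iff_labeledRho_ne l₂ hc) π hπ hππ ?_ (fun _ _ _ _ => hg _ _) h ?_
  · intro I hI I' hI' j hj j' hj' h
    have := mul_add_inj_of_mem_Icc hI hI' h
    rw [Finset.mem_Icc] at hj hj'
    omega
  · intro x hx
    refine labeledRho_of_notMem l d fun hmem => ?_
    obtain ⟨i, hi, j, hj, b, rfl⟩ := hl.exists_coordinates hmem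
    obtain ⟨I, hI, h⟩ := tensorLabel_eq_right hi b
    exact hx I hI j hj (h j)

end TensorDecomposition

theorem nonempty_labeling {N m : ℕ} {A : Chromotopology N} (hm : 0 < m)
    (h : Nat.card A.White = m) : Nonempty (A.Labeling m) := by
  have : Finite A.White := Nat.finite_of_card_ne_zero (h ▸ hm.ne')
  exact Finite.card_eq.1 (by
    rw [h, Nat.card_eq_fintype_card, Fintype.card_coe, Nat.card_Icc]; rfl)

end Chromotopology

end

theorem mainTheorem10 {N₁ N₂ k₁ k₂ : ℕ} (hN₁ : 0 < N₁) (hN₂ : 0 < N₂)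
    (C₁ : Submodule (ZMod 2) (Fin N₁ → ZMod 2)) (C₂ : Submodule (ZMod 2) (Fin N₂ → ZMod 2))
    (h₁ : DoublyEven C₁) (h₂ : DoublyEven C₂)
    (hk₁ : Module.finrank (ZMod 2) C₁ = k₁) (hk₂ : Module.finrank (ZMod 2) C₂ = k₂)
    (A₁ : Chromotopology N₁) (hA₁ : A₁ = Chromotopology.ofCode C₁ h₁)
    (A₂ : Chromotopology N₂) (hA₂ : A₂ = Chromotopology.ofCode C₂ h₂)
    (A : Chromotopology (N₁ + N₂)) (hA : A = A₁.tensor A₂)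
    (m₁ m₂ : ℕ) (hm₁ : m₁ = 2 ^ (N₁ - k₁ - 1)) (hm₂ : m₂ = 2 ^ (N₂ - k₂ - 1)) :
    -- the tensor product is an `(N₁ + N₂, k₁ + k₂)` chromotopology
    (∃ (C : Submodule (ZMod 2) (Fin (N₁ + N₂) → ZMod 2)) (h : DoublyEven C),
      Module.finrank (ZMod 2) C = k₁ + k₂ ∧
        Nonempty (A.Iso (Chromotopology.ofCode C h))) ∧
    -- the face permutations generate the monodromy groups
    A₁.MonodromyGeneratedBy {σ | ∃ c : Fin N₁, (c : ℕ) + 1 < N₁ ∧ σ = A₁.rho c} ∧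
    A₂.MonodromyGeneratedBy {σ | ∃ c : Fin N₂, (c : ℕ) + 1 < N₂ ∧ σ = A₂.rho c} ∧
    A.MonodromyGeneratedBy {σ | ∃ c : Fin (N₁ + N₂), (c : ℕ) + 1 < N₁ + N₂ ∧ σ = A.rho c} ∧
    -- the white vertices of the factors can be labelled, and the `ρ_c` of the factors are products
    -- of disjoint 2-cycles
    Nonempty (A₁.Labeling m₁) ∧ Nonempty (A₂.Labeling m₂) ∧
    (2 ≤ N₁ → ∀ (l₁ : A₁.Labeling m₁) (c : Fin N₁),
      ∃ L, IsTwoCycleDecomposition (Chromotopology.labeledRho l₁ c) L) ∧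
    (2 ≤ N₂ → ∀ (l₂ : A₂.Labeling m₂) (c : Fin N₂),
      ∃ L, IsTwoCycleDecomposition (Chromotopology.labeledRho l₂ c) L) ∧
    -- for all labellings of the factors there is a labelling of the tensor product such that
    ∀ (l₁ : A₁.Labeling m₁) (l₂ : A₂.Labeling m₂),
      ∃ l : A.Labeling (2 ^ (N₁ + N₂ - (k₁ + k₂) - 1)),
        -- `ρ_c` for `1 ≤ c ≤ N₁ - 1`
        (∀ c : Fin N₁, (c : ℕ) + 1 < N₁ →
          ∀ L, IsTwoCycleDecomposition (Chromotopology.labeledRho l₁ c) L →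
            Chromotopology.labeledRho l (Fin.castAdd N₂ c) =
              orderedProd (2 ^ (N₂ - k₂)) fun j =>
                relabel L (fun i => (j - 1) * m₁ + i) (fun i => (j - 1) * m₁ + i)) ∧
        -- `ρ_{N₁ + c}` for `1 ≤ c ≤ N₂ - 1`
        (∀ c : Fin N₂, (c : ℕ) + 1 < N₂ →
          ∀ L, IsTwoCycleDecomposition (Chromotopology.labeledRho l₂ c) L →
            Chromotopology.labeledRho l (Fin.natAdd N₁ c) =
              orderedProd (2 ^ (N₁ - k₁)) fun i =>
                relabel L (fun j => (j - 1) * 2 ^ (N₁ - k₁) + i)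
                  (fun j => (j - 1) * 2 ^ (N₁ - k₁) + i)) ∧
        -- `ρ_{N₁}`, as a product of 2-cycles and entry by entry
        (∀ c : Fin N₁, (c : ℕ) + 1 = N₁ →
          (2 ≤ N₁ → ∀ L, IsTwoCycleDecomposition (Chromotopology.labeledRho l₁ c) L →
            Chromotopology.labeledRho l (Fin.castAdd N₂ c) =
              orderedProd (2 ^ (N₂ - k₂)) fun J =>
                relabel L (fun i => (J - 1) * m₁ + i) (fun i => (partner J - 1) * m₁ + i)) ∧
          ∀ J ∈ Finset.Icc 1 (2 ^ (N₂ - k₂)), ∀ i ∈ Finset.Icc 1 m₁,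
            Chromotopology.labeledRho l (Fin.castAdd N₂ c) ((J - 1) * m₁ + i) =
              (partner J - 1) * m₁ + Chromotopology.labeledRho l₁ c i) ∧
        -- `ρ_{N₁ + N₂}`, as the product of the others, as a product of 2-cycles and entry by entry
        (∀ c : Fin N₂, (c : ℕ) + 1 = N₂ →
          A.rho (Fin.natAdd N₁ c) = ((List.finRange (N₁ + N₂)).dropLast.map A.rho).prod ∧
          (2 ≤ N₂ → ∀ L, IsTwoCycleDecomposition (Chromotopology.labeledRho l₂ c) L →
            Chromotopology.labeledRho l (Fin.natAdd N₁ c) =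
              orderedProd (2 ^ (N₁ - k₁)) fun I =>
                relabel L (fun j => (j - 1) * 2 ^ (N₁ - k₁) + I)
                  (fun j => if I ≤ m₁ then (j - 1) * 2 ^ (N₁ - k₁) + I + m₁
                    else (j - 1) * 2 ^ (N₁ - k₁) + I - m₁)) ∧
          ∀ I ∈ Finset.Icc 1 (2 ^ (N₁ - k₁)), ∀ j ∈ Finset.Icc 1 m₂,
            Chromotopology.labeledRho l (Fin.natAdd N₁ c) ((j - 1) * 2 ^ (N₁ - k₁) + I) =
              if I ≤ m₁ then
                (Chromotopology.labeledRho l₂ c j - 1) * 2 ^ (N₁ - k₁) + I + m₁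
              else (Chromotopology.labeledRho l₂ c j - 1) * 2 ^ (N₁ - k₁) + I - m₁) := by
  subst hA hA₁ hA₂
  -- The strict inequalities make the truncated subtractions in the exponents exact.
  have hk₁' := h₁.finrank_lt hN₁
  have hk₂' := h₂.finrank_lt hN₂
  rw [hk₁] at hk₁'
  rw [hk₂] at hk₂'
  have hM₁ : 2 ^ (N₁ - k₁) = 2 * m₁ := by
    rw [hm₁, ← pow_succ']
    congr 1
    omega
  have hM₂ : 2 ^ (N₂ - k₂) = 2 * m₂ := by
    rw [hm₂, ← pow_succ']
    congr 1
    omega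
  have hM : 2 ^ (N₁ + N₂ - (k₁ + k₂) - 1) = 2 * m₂ * m₁ := by
    rw [← hM₂, hm₁, ← pow_add]
    congr 1
    omega
  have hm₁' : 0 < m₁ := hm₁ ▸ Nat.two_pow_pos _
  have hm₂' : 0 < m₂ := hm₂ ▸ Nat.two_pow_pos _
  have hcard₁ : Nat.card (Chromotopology.ofCode C₁ h₁).White = m₁ := by
    rw [Chromotopology.card_white_ofCode hN₁ h₁, hk₁, hm₁]
  have hcard₂ : Nat.card (Chromotopology.ofCode C₂ h₂).White = m₂ := by
    rw [Chromotopology.card_white_ofCode hN₂ h₂, hk₂, hm₂]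
  have hrank := Chromotopology.finrank_ker_tensorMap C₁ C₂
  rw [hk₁, hk₂] at hrank
  have hcard : Nat.card ((Chromotopology.ofCode C₁ h₁).tensor (Chromotopology.ofCode C₂ h₂)).White =
      2 ^ (N₁ + N₂ - (k₁ + k₂) - 1) := by
    rw [Nat.card_congr (Chromotopology.tensorIso h₁ h₂).whiteEquiv,
      Chromotopology.card_white_ofCode (Nat.add_pos_left hN₁ N₂), hrank]
  have hconn₁ := Chromotopology.connected_ofCode C₁ h₁
  have hconn₂ := Chromotopology.connected_ofCode C₂ h₂
  refine ⟨⟨_, Chromotopology.doublyEven_ker_tensorMap h₁ h₂, hrank,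
    ⟨Chromotopology.tensorIso h₁ h₂⟩⟩, hconn₁.monodromyGeneratedBy hN₁,
    hconn₂.monodromyGeneratedBy hN₂,
    (hconn₁.tensor hconn₂).monodromyGeneratedBy (Nat.add_pos_left hN₁ N₂),
    Chromotopology.nonempty_labeling hm₁' hcard₁, Chromotopology.nonempty_labeling hm₂' hcard₂,
    fun _ l₁ c => Chromotopology.exists_isTwoCycleDecomposition_labeledRho l₁ c,
    fun _ l₂ c => Chromotopology.exists_isTwoCycleDecomposition_labeledRho l₂ c, fun l₁ l₂ => ?_⟩
  -- White ends are taken along the first colours, the only choice for which the two mixed face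
  -- permutations take the stated form.
  obtain ⟨l, hl⟩ := Chromotopology.exists_isTensorLabeling ⟨0, hN₁⟩ ⟨0, hN₂⟩ l₁ l₂ hM hcard
  refine ⟨l, ?_⟩
  rw [hM₁, hM₂]
  have hlast₁ (c : Fin N₁) (hc : (c : ℕ) + 1 = N₁) : ∀ J ∈ Finset.Icc 1 (2 * m₂),
      ∀ i ∈ Finset.Icc 1 m₁, Chromotopology.labeledRho l (Fin.castAdd N₂ c) ((J - 1) * m₁ + i) =
        (partner J - 1) * m₁ + Chromotopology.labeledRho l₁ c i := by
    intro J hJ i hi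
    obtain ⟨j, hj, b, h⟩ := exists_tensorLabel_left hJ
    rw [(h _ _).1, (h _ _).2, hl.castAdd_last rfl rfl hc hi hj b]
  have hlast₂ (c : Fin N₂) (hc : (c : ℕ) + 1 = N₂) : ∀ I ∈ Finset.Icc 1 (2 * m₁),
      ∀ j ∈ Finset.Icc 1 m₂,
        Chromotopology.labeledRho l (Fin.natAdd N₁ c) ((j - 1) * (2 * m₁) + I) =
          (Chromotopology.labeledRho l₂ c j - 1) * (2 * m₁) + halfSwap m₁ I := by
    intro I hI j hj
    obtain ⟨i, hi, b, h⟩ := exists_tensorLabel_right hI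
    rw [(h _).1, (h _).2, hl.natAdd_last rfl rfl hc hi hj b]
  refine ⟨fun c hc L hL => ?_, fun c hc L hL => ?_, fun c hc => ⟨fun hN L hL => ?_, hlast₁ c hc⟩,
    fun c hc => ⟨?_, fun hN L hL => ?_, fun I hI j hj => ?_⟩⟩
  · refine hl.eq_orderedProd_left (π := id) (Chromotopology.rho_ofCode_ne (by omega) h₁ c) hL
      (fun _ hJ => hJ) (fun _ _ => rfl) fun J hJ i hi => ?_
    obtain ⟨j, hj, b, h⟩ := exists_tensorLabel_left hJ
    rw [id, (h _ _).1, (h _ _).1, hl.castAdd_of_lt hc hi hj b]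
  · refine hl.eq_orderedProd_right (π := id) (Chromotopology.rho_ofCode_ne (by omega) h₂ c) hL
      (fun _ hI => hI) (fun _ _ => rfl) (fun _ _ => rfl) fun I hI j hj => ?_
    obtain ⟨i, hi, b, h⟩ := exists_tensorLabel_right hI
    rw [id, (h _).1, (h _).1, hl.natAdd_of_lt hc hi hj b]
  · exact hl.eq_orderedProd_left (Chromotopology.rho_ofCode_ne hN h₁ c) hL
      (fun _ => partner_mem) (fun _ hJ => partner_partner (Finset.mem_Icc.1 hJ).1) (hlast₁ c hc)
  · exact Chromotopology.rho_last_eq_prod _ (by simp only [Fin.val_natAdd]; omega)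
  · exact hl.eq_orderedProd_right (Chromotopology.rho_ofCode_ne hN h₂ c) hL
      (fun _ => halfSwap_mem) (fun _ => halfSwap_halfSwap) (fun _ _ => (add_halfSwap _ _ _).symm)
      (hlast₂ c hc)
  · rw [hlast₂ c hc I hI j hj, add_halfSwap]
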